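/- Let $\Omega\subset\mathbb R$ be compact, $m_\Omega=\sup_{\omega\in\Omega}|\omega|$, and let $B(\Omega)$ be the space of $f\in L^2(\mathbb R)$ whose Fourier transform $\hat f(\omega)=\int f(x)e^{-i\omega x}\,dx$ is supported in $\Omega$; elements of $B(\Omega)$ are identified with their continuous (hence smooth) representatives. Put $\Phi_\Omega(x)=\frac1{2\pi}\int_\Omega e^{i\omega x}\,d\omega$. Let $\{x_{n,0}\}_{n\in I}$ be a countable set of distinct real points with $\delta=\sup_{x\in\mathbb R}\inf_{n\in I}|x-x_{n,0}|<\infty$, whose Voronoi regions $V_n=\{x:|x-x_{n,0}|\le|x-x_{k,0}|\ \forall k\in I\}$ cover $\mathbb R$. Let $s\ge 0$ be an integer and $$\mu_{n,m}=\frac1{m!}\int_{V_n}(x-x_{n,0})^{2m}\,dx ,\qquad n\in I,\ m=0,\dots,s.$$ A bunched sampling set of width $h$ around these points consists of, for each $n$, distinct points $x_{n,0},x_{n,1},\dots,x_{n,s}\in[x_{n,0}-h_n,x_{n,0}+h_n]\subseteq V_n$ with $\sup_n h_n=h$; write $D_{x_{n,0},\dots,x_{n,m}}f$ for divided differences and $N_{n,m}(x)=\prod_{l<m}(x-x_{n,l})$.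 For $\tau\ge0$ let $\tilde H_{s,\tau}$ be the inverse function of $\tilde h_{s,\tau}(z)=\frac{(1+\tau)^s z^{s+1}}{(s+1)!}\left(1+\frac{4z}{\pi}\right)$ on $(0,\infty)$. (1) $\tilde H_{s,\tau}(1)\sim \frac{s+1}{e}$ as $s\to\infty$ and $\tau\to0$ ($\tau\ge 0$), jointly. (2) For every $f\in B(\Omega)$, over bunched sampling sets of width $\tau\delta$ around the points $x_{n,0}$ (with $\tau>0$), $$\lim_{\tau\to0}\ \sum_{n\in I}\sum_{m=0}^s m!\int_{V_n}|N_{n,m}(x)|^2dx\,\left|D_{x_{n,0},\dots,x_{n,m}}f\right|^2=\sum_{n\in I}\sum_{m=0}^s\mu_{n,m}\,|f^{(m)}(x_{n,0})|^2 ,$$ uniformly over the choice of the bunched sampling set of width $\tau\delta$; the right-hand sum is finite, and so are the left-hand sums for all sufficiently small $\tau$. (3) If $\delta\, m_\Omega<\frac{s+1}{e}$ (that is, $\delta<\frac{1}{e}\frac{s+1}{m_\Omega}$ when $m_\Omega>0$), then $\left\{\sqrt{\mu_{n,m}}\,\frac{d^m}{dx^m}\Phi_\Omega(\cdot-x_{n,0}):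 n\in I,\ m=0,\dots,s\right\}$ is a frame for $B(\Omega)$, with an upper frame bound $$B\le \left(1+\tfrac{2\delta m_\Omega}{\pi}\right)^2e^{(\delta m_\Omega)^2}.$$ If moreover $\delta\, m_\Omega<\tilde H_{s,0}(1)$ (which, by (1), holds for all large $s$ as soon as $\delta\,m_\Omega\le(1-\varepsilon)\frac{s+1}{e}$ for a fixed $\varepsilon>0$), then it is a frame with that upper bound and with a lower frame bound $$A\ge e^{-1}\left(1-\frac{(\delta m_\Omega)^{s+1}}{(s+1)!}\left(1+\frac{4\delta m_\Omega}{\pi}\right)\right)^2 .$$ -/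

import Mathlib

open MeasureTheory Set Filter Topology FourierTransform

noncomputable section

namespace BunchedSampling

/-- The space `B(Ω)` of functions in `L²(ℝ)` whose Fourier transform
`∫ f(x) exp(-iωx) dx` is supported in the closed set `Ω`, that is, vanishes almost everywhere
outside `Ω`.  Mathlib's transform uses the kernel `exp(-2πixξ)`, hence `ω = 2πξ`. -/
def bandlimited (Ω : Set ℝ) : Submodule ℂ (Lp ℂ 2 (volume : Measure ℝ)) where
  carrier := {f | ∀ᵐ ξ : ℝ, 2 * Real.pi * ξ ∉ Ω → (𝓕 f : Lp ℂ 2 (volume : Measure ℝ)) ξ = 0}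
  add_mem' := by
    intro f g hf hg
    have h : (𝓕 (f + g) : Lp ℂ 2 (volume : Measure ℝ)) = 𝓕 f + 𝓕 g :=
      (Lp.fourierTransformₗᵢ ℝ ℂ).map_add f g
    simp only [mem_ofPred_eq] at hf hg ⊢
    rw [h]
    filter_upwards [hf, hg, Lp.coeFn_add (𝓕 f : Lp ℂ 2 (volume : Measure ℝ)) (𝓕 g)]
      with ξ h1 h2 h3 h4
    rw [h3, Pi.add_apply, h1 h4, h2 h4, add_zero]
  zero_mem' := by
    have h : (𝓕 (0 : Lp ℂ 2 (volume : Measure ℝ)) : Lp ℂ 2 (volume : Measure ℝ)) = 0 :=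
      (Lp.fourierTransformₗᵢ ℝ ℂ).map_zero
    simp only [mem_ofPred_eq]
    rw [h]
    filter_upwards [Lp.coeFn_zero ℂ 2 (volume : Measure ℝ)] with ξ h1 _
    rw [h1, Pi.zero_apply]
  smul_mem' := by
    intro c f hf
    have h : (𝓕 (c • f) : Lp ℂ 2 (volume : Measure ℝ)) = c • 𝓕 f :=
      (Lp.fourierTransformₗᵢ ℝ ℂ).map_smul c f
    simp only [mem_ofPred_eq] at hf ⊢
    rw [h]
    filter_upwards [hf, Lp.coeFn_smul c (𝓕 f : Lp ℂ 2 (volume : Measure ℝ))] with ξ h1 h2 h3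
    rw [h2, Pi.smul_apply, h1 h3, smul_zero]

/-- `m_Ω = sup_{ω ∈ Ω} |ω|`. -/
def maxFreq (Ω : Set ℝ) : ℝ := sSup ((fun ω : ℝ => |ω|) '' Ω)

/-- `Φ_Ω(x) = (2π)⁻¹ ∫_Ω exp(iωx) dω`. -/
def Phi (Ω : Set ℝ) (x : ℝ) : ℂ :=
  (1 / (2 * Real.pi) : ℂ) * ∫ ω in Ω, Complex.exp (Complex.I * ω * x)

/-- The Voronoi region of the point `x n` among the points `x`. -/
def voronoi {I : Type*} (x : I → ℝ) (n : I) : Set ℝ :=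
  {t | ∀ k, |t - x n| ≤ |t - x k|}

/-- `sup_{t ∈ ℝ} inf_n |t - x n|`, with values in `[0, ∞]`. -/
def density {I : Type*} (x : I → ℝ) : ENNReal :=
  ⨆ t : ℝ, ⨅ n, ENNReal.ofReal |t - x n|

/-- `{y n m}` with `n ∈ I`, `0 ≤ m ≤ s` is a bunched sampling set around the points
`x n = y n 0`, with bunch width `h = sup h_n`. -/
structure IsBunched {I : Type*} {s : ℕ} (x : I → ℝ) (y : I → Fin (s + 1) → ℝ) (h : ℝ) :
    Prop where
  base : ∀ n, y n 0 = x n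
  distinct : ∀ n, Function.Injective (y n)
  width : ∃ w : I → ℝ, (∀ n, 0 ≤ w n) ∧
    (∀ n m, y n m ∈ Icc (x n - w n) (x n + w n)) ∧
    (∀ n, Icc (x n - w n) (x n + w n) ⊆ voronoi x n) ∧
    IsLUB (range w) h

/-- The divided difference of `f` at the distinct points `y 0, …, y m`. -/
def divDiff {s : ℕ} (y : Fin (s + 1) → ℝ) (m : Fin (s + 1)) (f : ℝ → ℂ) : ℂ :=
  ∑ k ∈ Finset.Iic m, f (y k) / ∏ j ∈ (Finset.Iic m).erase k, ((y k : ℂ) - (y j : ℂ))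

/-- The Newton polynomial `∏_{l < m} (t - y l)`. -/
def newton {s : ℕ} (y : Fin (s + 1) → ℝ) (m : Fin (s + 1)) (t : ℝ) : ℝ :=
  ∏ l ∈ Finset.Iio m, (t - y l)

/-- The weights `m! ∫_{V_n} N_{n,m}(t)² dt` of the divided-difference frame. -/
def newtonWeight {I : Type*} {s : ℕ} (x : I → ℝ) (y : I → Fin (s + 1) → ℝ) (n : I)
    (m : Fin (s + 1)) : ℝ :=
  (Nat.factorial m : ℝ) * ∫ t in voronoi x n, newton (y n) m t ^ 2

/-- The monomial Voronoi weights `(1/m!) ∫_{V_n} (t - x_n)^{2m} dt`. -/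
def monomialWeight {I : Type*} (x : I → ℝ) (n : I) (m : ℕ) : ℝ :=
  1 / (Nat.factorial m : ℝ) * ∫ t in voronoi x n, (t - x n) ^ (2 * m)

/-- The family `φ` is a frame for the Hilbert space `H` with frame bounds `A` and `B`. -/
structure IsFrameWithBounds {H : Type*} [NormedAddCommGroup H] [InnerProductSpace ℂ H]
    {ι : Type*} (φ : ι → H) (A B : ℝ) : Prop where
  lower_pos : 0 < A
  upper_pos : 0 < B
  summable : ∀ f : H, Summable fun i => ‖inner ℂ (φ i) f‖ ^ 2
  lower : ∀ f : H, A * ‖f‖ ^ 2 ≤ ∑' i, ‖inner ℂ (φ i) f‖ ^ 2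
  upper : ∀ f : H, ∑' i, ‖inner ℂ (φ i) f‖ ^ 2 ≤ B * ‖f‖ ^ 2

/-- `h̃_{s,τ}(z) = (1+τ)^s z^{s+1} / (s+1)! * (1 + 4z/π)`. -/
def hTilde (s : ℕ) (τ z : ℝ) : ℝ :=
  (1 + τ) ^ s * z ^ (s + 1) / (Nat.factorial (s + 1) : ℝ) * (1 + 4 * z / Real.pi)

/-- `H̃_{s,τ}`, the inverse function of the increasing bijection `h̃_{s,τ}` of `(0,∞)`. -/
def HTilde (s : ℕ) (τ : ℝ) : ℝ → ℝ :=
  Function.invFunOn (hTilde s τ) (Ioi 0)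

end BunchedSampling

end

/-! By Parseval, the inner product of f with the m-th derivative of Φ_Ω(· - x) is f^(m)(x) up to
sign (`exists_bandlimited_phi`), so the frame sums are weighted sums of derivative samples.
Bernstein's inequality bounds the L² norm of f^(m) by m_Ω^m ‖f‖. Every Voronoi cell is an interval
reaching at most δ to either side of its centre, and the cells tile the line up to null sets, so
estimates on one cell add up to global ones.

Upper bound: Wirtinger's inequality compares f^(m)(x_n) with f^(m) on the cell at the cost of a
factor 1 + 2δm_Ω/π; summing (δm_Ω)^(2m)/m! over m produces the exponential. Lower bound: on each
cell f is its Taylor polynomial at x_n plus a remainder. Cauchy–Schwarz with Σ 1/m! ≤ e bounds the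
polynomial by the weighted samples, and the remainder has global norm at most (δm_Ω)^(s+1)/(s+1)!
‖f‖ (`lower_bound_monomialWeight_mul`). This factor is below 1 when δm_Ω < (s+1)/e, because (n/e)^n
≤ n!.

Limit: by the mean value theorem m! times a divided difference is close to f^(m)(x_n), with squared
error at most the bunch diameter times a cell integral of |f^(m+1)|² (`norm_divDiff_sub_sq_le`). The
error is summable over the cells and depends on the bunched set only through τ, which gives
uniformity. The asymptotics of H̃ follow from crude two-sided Stirling bounds. -/

noncomputable section

namespace BunchedSampling

/-! ### The inverse Fourier transform on L¹ ∩ L² -/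

open Complex in
/-- On `L¹ ∩ L²`, the inverse Fourier transform on `L²` is given by the integral. -/
theorem coeFn_fourierInv_of_integrable (g : Lp ℂ 2 (volume : Measure ℝ))
    (hg : Integrable (g : ℝ → ℂ)) :
    ((𝓕⁻ g : Lp ℂ 2 (volume : Measure ℝ)) : ℝ → ℂ) =ᵐ[volume] 𝓕⁻ (g : ℝ → ℂ) := by
  have hcont : Continuous (𝓕⁻ (g : ℝ → ℂ)) :=
    VectorFourier.fourierIntegral_continuous (by fun_prop) (by fun_prop) hg
  refine ae_eq_of_integral_contDiff_smul_eq
    ((Lp.memLp _).locallyIntegrable (by norm_num)) hcont.locallyIntegrable ?_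
  intro φ hφ hφs
  have h1 : HasCompactSupport (fun x => (φ x : ℂ)) := hφs.comp_left (g := fun x : ℝ => (x : ℂ)) rfl
  have h2 : ContDiff ℝ (⊤ : ℕ∞) (fun x => (φ x : ℂ)) := by
    exact ofRealCLM.contDiff.comp hφ
  set Φ : SchwartzMap ℝ ℂ := h1.toSchwartzMap h2 with hΦ
  have hΦa : ∀ x, Φ x = (φ x : ℂ) := fun x => rfl
  -- Both candidates are tested against Φ: duality of tempered distributions moves the L² transform
  -- onto Φ, and Fubini (`swap`) moves the integral transform back onto g.
  have key : (Lp.toTemperedDistribution (𝓕⁻ g : Lp ℂ 2 (volume : Measure ℝ))) Φ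
      = (Lp.toTemperedDistribution g) (𝓕⁻ Φ) := by
    rw [← Lp.fourierInv_toTemperedDistribution_eq]; rfl
  rw [Lp.toTemperedDistribution_apply, Lp.toTemperedDistribution_apply] at key
  have swap := VectorFourier.integral_fourierIntegral_smul_eq_flip (e := Real.fourierChar)
    (μ := (volume : Measure ℝ)) (ν := (volume : Measure ℝ)) (L := -innerₗ ℝ) (f := Φ)
    (g := (g : ℝ → ℂ)) (by fun_prop) (by fun_prop) Φ.integrable hg
  have hflip : (-innerₗ ℝ : ℝ →ₗ[ℝ] ℝ →ₗ[ℝ] ℝ).flip = -innerₗ ℝ := by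
    ext; simp
  rw [hflip] at swap
  have h3 : ∀ x, (𝓕⁻ Φ : SchwartzMap ℝ ℂ) x =
      VectorFourier.fourierIntegral Real.fourierChar volume (-innerₗ ℝ) Φ x := by
    intro x
    rw [SchwartzMap.fourierInv_coe]; rfl
  simp_rw [h3] at key
  rw [swap] at key
  simp only [hΦa] at key
  exact key

theorem norm_sq_eq_integral (f : Lp ℂ 2 (volume : Measure ℝ)) :
    ‖f‖ ^ 2 = ∫ x, ‖f x‖ ^ 2 := by
  have h : ((‖f‖ ^ 2 : ℝ) : ℂ) = ((∫ x, ‖f x‖ ^ 2 : ℝ) : ℂ) := by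
    have := inner_self_eq_norm_sq_to_K (𝕜 := ℂ) f
    rw [L2.inner_def] at this
    rw [← integral_complex_ofReal]
    push_cast
    simp only [inner_self_eq_norm_sq_to_K] at this
    exact this.symm
  exact_mod_cast h

theorem coeFn_fourierInv_toLp {g : ℝ → ℂ} (hg1 : Integrable g) (hg2 : MemLp g 2) :
    ((𝓕⁻ (hg2.toLp g) : Lp ℂ 2 (volume : Measure ℝ)) : ℝ → ℂ) =ᵐ[volume] 𝓕⁻ g := by
  have h := coeFn_fourierInv_of_integrable (hg2.toLp g) (hg1.congr hg2.coeFn_toLp.symm)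
  have h2 : 𝓕⁻ (hg2.toLp g : ℝ → ℂ) = 𝓕⁻ g := by
    ext x
    exact Real.fourierInv_congr_ae hg2.coeFn_toLp x
  rwa [h2] at h

theorem memLp_fourierInv {g : ℝ → ℂ} (hg1 : Integrable g) (hg2 : MemLp g 2) :
    MemLp (𝓕⁻ g) 2 :=
  (Lp.memLp _).ae_eq (coeFn_fourierInv_toLp hg1 hg2)

theorem norm_fourierInv_eq (g : Lp ℂ 2 (volume : Measure ℝ)) : ‖𝓕⁻ g‖ = ‖g‖ :=
  (Lp.fourierTransformₗᵢ ℝ ℂ).symm.norm_map g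

theorem integral_norm_sq_fourierInv {g : ℝ → ℂ} (hg1 : Integrable g) (hg2 : MemLp g 2) :
    ∫ x, ‖𝓕⁻ g x‖ ^ 2 = ∫ x, ‖g x‖ ^ 2 := by
  have h1 := norm_sq_eq_integral (𝓕⁻ (hg2.toLp g))
  have h2 := norm_sq_eq_integral (hg2.toLp g)
  rw [norm_fourierInv_eq, h2] at h1
  rw [integral_congr_ae (g := fun x => ‖g x‖ ^ 2)] at h1
  · rw [h1]
    refine integral_congr_ae ?_
    filter_upwards [coeFn_fourierInv_toLp hg1 hg2] with x hx
    rw [hx]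
  · filter_upwards [hg2.coeFn_toLp] with x hx
    rw [hx]

/-! ### Compactly supported spectra and Bernstein's inequality -/

/-- A square integrable function which vanishes almost everywhere outside the frequency
interval `[-M, M]`. -/
structure IsSpectrum (M : ℝ) (g : ℝ → ℂ) : Prop where
  memLp : MemLp g 2 (volume : Measure ℝ)
  ae_zero : ∀ᵐ ξ : ℝ, M < |2 * Real.pi * ξ| → g ξ = 0

namespace IsSpectrum

variable {M : ℝ} {g : ℝ → ℂ}

/-- The support has finite length, and there L² is contained in L¹. This makes the integral form of
the transform available for every derivative. -/
theorem integrable (h : IsSpectrum M g) : Integrable g := by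
  set K : Set ℝ := Icc (-(M / (2 * Real.pi))) (M / (2 * Real.pi)) with hK
  have hg : K.indicator g =ᵐ[volume] g := by
    filter_upwards [h.ae_zero] with ξ hξ
    by_cases hm : ξ ∈ K
    · rw [indicator_of_mem hm]
    · rw [indicator_of_notMem hm, hξ]
      by_contra! hc
      refine hm ?_
      have hp := Real.pi_pos
      rw [hK, mem_Icc, ← abs_le, le_div_iff₀ (by positivity)]
      rwa [abs_mul, abs_of_pos (by positivity : 0 < 2 * Real.pi), mul_comm] at hc
  refine Integrable.congr ?_ hg
  rw [integrable_indicator_iff measurableSet_Icc]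
  have : IsFiniteMeasure (volume.restrict K) := ⟨by simp [hK]⟩
  exact (h.memLp.restrict K).integrable (by norm_num)

theorem norm_mul_le (h : IsSpectrum M g) :
    ∀ᵐ ξ : ℝ, ‖(2 * Real.pi * Complex.I * ξ) * g ξ‖ ≤ M * ‖g ξ‖ := by
  filter_upwards [h.ae_zero] with ξ hξ
  by_cases hm : M < |2 * Real.pi * ξ|
  · simp [hξ hm]
  · rw [norm_mul]
    gcongr
    push Not at hm
    refine le_trans (le_of_eq ?_) hm
    simp [abs_mul]

theorem mul (h : IsSpectrum M g) :
    IsSpectrum M fun ξ => (2 * Real.pi * Complex.I * ξ) * g ξ where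
  memLp := by
    refine h.memLp.of_le_mul (c := M) ?_ h.norm_mul_le
    exact Continuous.aestronglyMeasurable (by fun_prop) |>.mul h.memLp.1
  ae_zero := by
    filter_upwards [h.ae_zero] with ξ hξ hm
    rw [hξ hm, mul_zero]

theorem pow_mul (h : IsSpectrum M g) (k : ℕ) :
    IsSpectrum M fun ξ => (2 * Real.pi * Complex.I * ξ) ^ k * g ξ := by
  induction k with
  | zero => simpa using h
  | succ k ih => simpa [pow_succ', mul_assoc] using ih.mul

theorem norm_pow_mul_le (hM : 0 ≤ M) (h : IsSpectrum M g) (k : ℕ) :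
    ∀ᵐ ξ : ℝ, ‖(2 * Real.pi * Complex.I * ξ) ^ k * g ξ‖ ≤ M ^ k * ‖g ξ‖ := by
  induction k with
  | zero => simp
  | succ k ih =>
    filter_upwards [ih, (h.pow_mul k).norm_mul_le] with ξ h1 h2
    calc _ = ‖(2 * Real.pi * Complex.I * ξ) * ((2 * Real.pi * Complex.I * ξ) ^ k * g ξ)‖ := by
          rw [pow_succ', mul_assoc]
      _ ≤ M * (M ^ k * ‖g ξ‖) := h2.trans (by gcongr)
      _ = _ := by ring

theorem hasDerivAt_fourierInv (h : IsSpectrum M g) (w : ℝ) :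
    HasDerivAt (𝓕⁻ g) (𝓕⁻ (fun ξ : ℝ => (2 * Real.pi * Complex.I * ξ) * g ξ) w) w := by
  have h1 : Integrable (fun x : ℝ => x • g x) := by
    refine ((h.mul.integrable).const_mul (2 * Real.pi * Complex.I)⁻¹).congr
      (Eventually.of_forall fun x => ?_)
    simp only [Complex.real_smul]
    field_simp
  -- The minus sign in the derivative of `𝓕` cancels against the one from the reflection w ↦ -w.
  have h2 := Real.hasDerivAt_fourier h.integrable h1 (-w)
  have h3 : 𝓕⁻ g = fun w => 𝓕 g (-w) := by
    ext w; exact Real.fourierInv_eq_fourier_neg g w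
  rw [h3]
  convert! h2.scomp w (hasDerivAt_neg w) using 1
  rw [Real.fourierInv_eq_fourier_neg, neg_one_smul, Real.fourier_eq, Real.fourier_eq,
    ← integral_neg]
  congr 1
  ext v
  rw [← smul_neg]
  congr 1
  simp only [smul_eq_mul]
  ring

theorem iteratedDeriv_fourierInv (h : IsSpectrum M g) (k : ℕ) :
    iteratedDeriv k (𝓕⁻ g) = 𝓕⁻ (fun ξ : ℝ => (2 * Real.pi * Complex.I * ξ) ^ k * g ξ) := by
  induction k with
  | zero => simp
  | succ k ih =>
    rw [iteratedDeriv_succ, ih]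
    ext w
    rw [((h.pow_mul k).hasDerivAt_fourierInv w).deriv]
    simp only [pow_succ', mul_assoc]

theorem contDiff_fourierInv (h : IsSpectrum M g) (n : ℕ∞) : ContDiff ℝ n (𝓕⁻ g) := by
  refine contDiff_of_differentiable_iteratedDeriv fun k _ => ?_
  rw [h.iteratedDeriv_fourierInv]
  exact fun w => ((h.pow_mul k).hasDerivAt_fourierInv w).differentiableAt

theorem memLp_iteratedDeriv (h : IsSpectrum M g) (k : ℕ) :
    MemLp (iteratedDeriv k (𝓕⁻ g)) 2 := by
  rw [h.iteratedDeriv_fourierInv]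
  exact memLp_fourierInv (h.pow_mul k).integrable (h.pow_mul k).memLp

/-- Bernstein's inequality in L²: by Plancherel, differentiation is multiplication by 2πiξ, of
modulus at most M on the support. -/
theorem integral_iteratedDeriv_le (hM : 0 ≤ M) (h : IsSpectrum M g) (k : ℕ) :
    ∫ x, ‖iteratedDeriv k (𝓕⁻ g) x‖ ^ 2 ≤ (M ^ k) ^ 2 * ∫ x, ‖g x‖ ^ 2 := by
  rw [h.iteratedDeriv_fourierInv, integral_norm_sq_fourierInv (h.pow_mul k).integrable
    (h.pow_mul k).memLp, ← integral_const_mul]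
  refine integral_mono_ae ((h.pow_mul k).memLp.integrable_norm_pow (by norm_num))
    ((h.memLp.integrable_norm_pow (by norm_num)).const_mul _) ?_
  filter_upwards [h.norm_pow_mul_le hM k] with ξ hξ
  simp only [← mul_pow]
  gcongr

end IsSpectrum

/-! ### Continuous representatives of bandlimited functions -/

theorem maxFreq_nonneg (Ω : Set ℝ) : 0 ≤ maxFreq Ω :=
  Real.sSup_nonneg (by rintro _ ⟨x, _, rfl⟩; exact abs_nonneg x)

theorem abs_le_maxFreq {Ω : Set ℝ} (hΩ : IsCompact Ω) {ω : ℝ} (h : ω ∈ Ω) : |ω| ≤ maxFreq Ω :=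
  le_csSup (hΩ.image continuous_abs).bddAbove (mem_image_of_mem _ h)

theorem isSpectrum_fourier {Ω : Set ℝ} (hΩ : IsCompact Ω) (f : bandlimited Ω) :
    IsSpectrum (maxFreq Ω) (𝓕 (f : Lp ℂ 2 (volume : Measure ℝ)) : Lp ℂ 2 (volume : Measure ℝ)) where
  memLp := Lp.memLp _
  ae_zero := by
    filter_upwards [f.2] with ξ hξ hm
    exact hξ fun h => (abs_le_maxFreq hΩ h).not_gt hm

/-- The continuous representative of a bandlimited function. -/
def contRep {Ω : Set ℝ} (f : bandlimited Ω) : ℝ → ℂ :=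
  𝓕⁻ ((𝓕 (f : Lp ℂ 2 (volume : Measure ℝ)) : Lp ℂ 2 (volume : Measure ℝ)) : ℝ → ℂ)

theorem coeFn_ae_eq_contRep {Ω : Set ℝ} (hΩ : IsCompact Ω) (f : bandlimited Ω) :
    (f : Lp ℂ 2 (volume : Measure ℝ)) =ᵐ[volume] contRep f := by
  have h := coeFn_fourierInv_of_integrable _ (isSpectrum_fourier hΩ f).integrable
  rwa [FourierTransform.fourierInv_fourier_eq] at h

theorem contDiff_contRep {Ω : Set ℝ} (hΩ : IsCompact Ω) (f : bandlimited Ω) (n : ℕ∞) :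
    ContDiff ℝ n (contRep f) :=
  (isSpectrum_fourier hΩ f).contDiff_fourierInv n

/-- Continuous functions that agree almost everywhere agree everywhere, so results about `contRep f`
hold for any continuous representative. -/
theorem eq_contRep {Ω : Set ℝ} (hΩ : IsCompact Ω) (f : bandlimited Ω) {F : ℝ → ℂ}
    (hF : Continuous F)
    (h : (f : Lp ℂ 2 (volume : Measure ℝ)) =ᵐ[volume] F) : F = contRep f :=
  Continuous.ae_eq_iff_eq volume hF (contDiff_contRep hΩ f 0).continuous |>.1
    (h.symm.trans (coeFn_ae_eq_contRep hΩ f))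

theorem integrable_iteratedDeriv_contRep {Ω : Set ℝ} (hΩ : IsCompact Ω) (f : bandlimited Ω)
    (k : ℕ) :
    Integrable fun x => ‖iteratedDeriv k (contRep f) x‖ ^ 2 :=
  ((isSpectrum_fourier hΩ f).memLp_iteratedDeriv k).integrable_norm_pow (by norm_num)

theorem integral_iteratedDeriv_contRep_le {Ω : Set ℝ} (hΩ : IsCompact Ω) (f : bandlimited Ω)
    (k : ℕ) :
    ∫ x, ‖iteratedDeriv k (contRep f) x‖ ^ 2 ≤ (maxFreq Ω ^ k) ^ 2 * ‖f‖ ^ 2 := by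
  refine ((isSpectrum_fourier hΩ f).integral_iteratedDeriv_le (maxFreq_nonneg Ω) k).trans ?_
  rw [← norm_sq_eq_integral, Lp.norm_fourier_eq]
  rfl

theorem integral_contRep {Ω : Set ℝ} (hΩ : IsCompact Ω) (f : bandlimited Ω) :
    ∫ x, ‖contRep f x‖ ^ 2 = ‖f‖ ^ 2 := by
  change _ = ‖(f : Lp ℂ 2 (volume : Measure ℝ))‖ ^ 2
  rw [norm_sq_eq_integral]
  refine integral_congr_ae ?_
  filter_upwards [coeFn_ae_eq_contRep hΩ f] with x hx
  rw [hx]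

/-! ### Translates of Φ_Ω and derivative samples -/

/-- The Fourier transform of a translate of `Phi Ω`. -/
def phiSpectrum (Ω : Set ℝ) (x ξ : ℝ) : ℂ :=
  ((fun ξ : ℝ => 2 * Real.pi * ξ) ⁻¹' Ω).indicator
    (fun ξ => Complex.exp (-(2 * Real.pi * Complex.I * ξ * x))) ξ

theorem phiSpectrum_of_mem {Ω : Set ℝ} {ξ : ℝ} (h : 2 * Real.pi * ξ ∈ Ω) (x : ℝ) :
    phiSpectrum Ω x ξ = Complex.exp (-(2 * Real.pi * Complex.I * ξ * x)) :=
  indicator_of_mem (s := (fun ξ : ℝ => 2 * Real.pi * ξ) ⁻¹' Ω) h _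

theorem phiSpectrum_of_notMem {Ω : Set ℝ} {ξ : ℝ} (h : 2 * Real.pi * ξ ∉ Ω) (x : ℝ) :
    phiSpectrum Ω x ξ = 0 :=
  indicator_of_notMem (s := (fun ξ : ℝ => 2 * Real.pi * ξ) ⁻¹' Ω) h _

theorem isSpectrum_phiSpectrum {Ω : Set ℝ} (hΩ : IsCompact Ω) (x : ℝ) :
    IsSpectrum (maxFreq Ω) (phiSpectrum Ω x) where
  memLp := by
    have hK : IsCompact ((fun ξ : ℝ => 2 * Real.pi * ξ) ⁻¹' Ω) :=
      (Homeomorph.mulLeft₀ (2 * Real.pi) (by positivity)).isCompact_preimage.2 hΩ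
    unfold phiSpectrum
    rw [memLp_indicator_iff_restrict hK.measurableSet]
    have : IsFiniteMeasure (volume.restrict ((fun ξ : ℝ => 2 * Real.pi * ξ) ⁻¹' Ω)) :=
      ⟨by simpa using hK.measure_lt_top (μ := volume)⟩
    refine MemLp.of_bound (Continuous.aestronglyMeasurable (by fun_prop)) 1
      (Eventually.of_forall fun ξ => ?_)
    rw [Complex.norm_exp]
    simp
  ae_zero := by
    refine Eventually.of_forall fun ξ hξ => ?_
    exact phiSpectrum_of_notMem (fun h => (abs_le_maxFreq hΩ h).not_gt hξ) _

theorem fourierInv_phiSpectrum {Ω : Set ℝ} (hΩ : IsCompact Ω) (x : ℝ) :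
    𝓕⁻ (phiSpectrum Ω x) = fun u => Phi Ω (u - x) := by
  ext u
  have hp := Real.pi_pos
  have h := Measure.integral_comp_mul_left
    (Ω.indicator fun ω : ℝ => Complex.exp (Complex.I * ω * ((u - x : ℝ) : ℂ))) (2 * Real.pi)
  rw [Phi, ← integral_indicator hΩ.measurableSet]
  have h2 : (1 / (2 * Real.pi) : ℂ) = ((|(2 * Real.pi)⁻¹| : ℝ) : ℂ) := by
    rw [abs_of_pos (by positivity)]; push_cast; simp
  rw [h2, ← Complex.real_smul, ← h, Real.fourierInv_eq']
  congr 1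
  ext ξ
  by_cases hm : 2 * Real.pi * ξ ∈ Ω
  · rw [phiSpectrum_of_mem hm,
      indicator_of_mem hm, smul_eq_mul, ← Complex.exp_add]
    congr 1
    simp
    ring
  · rw [phiSpectrum_of_notMem hm,
      indicator_of_notMem hm, smul_zero]

/-- The spectrum of the m-th derivative of Φ_Ω(· - x) is (2πiξ)^m exp(-2πiξx) on Ω; pairing it with
`𝓕 f` gives, up to sign, the inversion integral for f^(m)(x). -/
theorem exists_bandlimited_phi {Ω : Set ℝ} (hΩ : IsCompact Ω) (x : ℝ) (m : ℕ) :
    ∃ ψ : bandlimited Ω,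
      (ψ : Lp ℂ 2 (volume : Measure ℝ)) =ᵐ[volume] iteratedDeriv m (fun u => Phi Ω (u - x)) ∧
      ∀ f : bandlimited Ω, ‖inner ℂ ψ f‖ = ‖iteratedDeriv m (contRep f) x‖ := by
  have hs := isSpectrum_phiSpectrum hΩ x
  have hsm := hs.pow_mul m
  have hFψ : 𝓕 (𝓕⁻ (hsm.memLp.toLp _) : Lp ℂ 2 (volume : Measure ℝ)) = hsm.memLp.toLp _ :=
    FourierTransform.fourier_fourierInv_eq _
  refine ⟨⟨𝓕⁻ (hsm.memLp.toLp _), ?_⟩, ?_, ?_⟩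
  · change ∀ᵐ ξ : ℝ, _
    rw [hFψ]
    filter_upwards [hsm.memLp.coeFn_toLp] with ξ h1 h2
    rw [h1, phiSpectrum_of_notMem h2, mul_zero]
  · rw [← fourierInv_phiSpectrum hΩ, hs.iteratedDeriv_fourierInv]
    exact coeFn_fourierInv_toLp hsm.integrable hsm.memLp
  · intro f
    change ‖inner ℂ (𝓕⁻ (hsm.memLp.toLp _) : Lp ℂ 2 (volume : Measure ℝ))
      (f : Lp ℂ 2 (volume : Measure ℝ))‖ = _
    rw [← Lp.inner_fourier_eq, hFψ, L2.inner_def, contRep,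
      (isSpectrum_fourier hΩ f).iteratedDeriv_fourierInv, Real.fourierInv_eq']
    -- Conjugating (2πiξ)^m produces (-1)^m; inserting this sign under the norm makes the integrands
    -- equal.
    have h1 : ∀ z : ℂ, ‖z‖ = ‖(-1) ^ m * z‖ := by intro z; simp
    rw [h1, ← integral_const_mul]
    congr 1
    refine integral_congr_ae ?_
    filter_upwards [hsm.memLp.coeFn_toLp, f.2] with ξ h2 h3
    rw [h2]
    by_cases hm : 2 * Real.pi * ξ ∈ Ω
    · rw [phiSpectrum_of_mem hm]
      simp only [RCLike.inner_apply, map_mul, map_pow, ← Complex.exp_conj, map_neg,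
        Complex.conj_ofReal, Complex.conj_I, map_ofNat, smul_eq_mul, mul_neg, neg_mul, neg_neg]
      rw [neg_pow (2 * Real.pi * Complex.I * ξ : ℂ), show (↑(2 * Real.pi * (x * (starRingEnd ℝ) ξ)) : ℂ) * Complex.I
        = 2 * Real.pi * Complex.I * ξ * x by simp; ring]
      have h4 : ((-1 : ℂ) ^ m) * (-1) ^ m = 1 := by rw [← mul_pow]; simp
      linear_combination (2 * Real.pi * Complex.I * ξ : ℂ) ^ m *
        Complex.exp (2 * Real.pi * Complex.I * ξ * x) *
        (𝓕 (f : Lp ℂ 2 (volume : Measure ℝ)) : Lp ℂ 2 (volume : Measure ℝ)) ξ * h4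
    · rw [h3 hm]; simp

/-! ### Asymptotics of H̃ through Stirling bounds -/

theorem hTilde_strictMonoOn (s : ℕ) {τ : ℝ} (hτ : 0 ≤ τ) : StrictMonoOn (hTilde s τ) (Ici 0) := by
  intro a ha b hb hab
  have ha : 0 ≤ a := ha
  have hb : 0 < b := ha.trans_lt hab
  have hp := Real.pi_pos
  unfold hTilde
  have h1 : (1 + τ) ^ s * a ^ (s + 1) / (Nat.factorial (s + 1) : ℝ)
      < (1 + τ) ^ s * b ^ (s + 1) / (Nat.factorial (s + 1) : ℝ) := by
    have : a ^ (s + 1) < b ^ (s + 1) := pow_lt_pow_left₀ hab ha (by omega)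
    gcongr
  have h2 : 1 + 4 * a / Real.pi ≤ 1 + 4 * b / Real.pi := by gcongr
  exact mul_lt_mul h1 h2 (by positivity) (by positivity)

theorem continuous_hTilde (s : ℕ) (τ : ℝ) : Continuous (hTilde s τ) := by
  unfold hTilde; fun_prop

theorem exists_hTilde_eq_one (s : ℕ) {τ : ℝ} (hτ : 0 ≤ τ) : ∃ z ∈ Ioi (0 : ℝ), hTilde s τ z = 1 := by
  have hp := Real.pi_pos
  have h0 : hTilde s τ 0 = 0 := by simp [hTilde]
  -- At b = (s+1)! the quotient b^(s+1)/(s+1)! is at least 1, and so are the other factors.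
  set b : ℝ := (Nat.factorial (s + 1) : ℝ) with hb
  have hb1 : 1 ≤ b := by rw [hb]; exact_mod_cast Nat.one_le_iff_ne_zero.2 (Nat.factorial_ne_zero _)
  have h1 : 1 ≤ hTilde s τ b := by
    unfold hTilde
    rw [← hb]
    have e1 : 1 ≤ (1 + τ) ^ s := one_le_pow₀ (by linarith)
    have e2 : b ≤ b ^ (s + 1) := le_self_pow₀ hb1 (by omega)
    have e3 : 1 ≤ (1 + τ) ^ s * b ^ (s + 1) / b := by
      rw [le_div_iff₀ (by linarith)]
      nlinarith
    have e4 : 1 ≤ 1 + 4 * b / Real.pi := by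
      have : 0 ≤ 4 * b / Real.pi := by positivity
      linarith
    nlinarith
  obtain ⟨z, hz, hz1⟩ := intermediate_value_Icc (show (0 : ℝ) ≤ b by linarith)
    (continuous_hTilde s τ).continuousOn (show (1 : ℝ) ∈ Icc _ _ from ⟨by rw [h0]; norm_num, h1⟩)
  refine ⟨z, lt_of_le_of_ne hz.1 ?_, hz1⟩
  rintro rfl
  rw [h0] at hz1
  norm_num at hz1

theorem HTilde_pos (s : ℕ) {τ : ℝ} (hτ : 0 ≤ τ) : 0 < HTilde s τ 1 :=
  Function.invFunOn_mem (exists_hTilde_eq_one s hτ)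

theorem hTilde_HTilde (s : ℕ) {τ : ℝ} (hτ : 0 ≤ τ) : hTilde s τ (HTilde s τ 1) = 1 :=
  Function.invFunOn_eq (exists_hTilde_eq_one s hτ)

/-- Monotonicity turns comparisons with the inverse function into comparisons of `hTilde` with 1, so
the inverse never has to be computed. -/
theorem lt_HTilde_iff (s : ℕ) {τ z : ℝ} (hτ : 0 ≤ τ) (hz : 0 ≤ z) :
    z < HTilde s τ 1 ↔ hTilde s τ z < 1 := by
  rw [← (hTilde_strictMonoOn s hτ).lt_iff_lt hz (HTilde_pos s hτ).le, hTilde_HTilde s hτ]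

theorem HTilde_lt_iff (s : ℕ) {τ z : ℝ} (hτ : 0 ≤ τ) (hz : 0 ≤ z) :
    HTilde s τ 1 < z ↔ 1 < hTilde s τ z := by
  rw [← (hTilde_strictMonoOn s hτ).lt_iff_lt (HTilde_pos s hτ).le hz, hTilde_HTilde s hτ]

/-- The number n^n/n! is a single term of the exponential series of e^n. -/
theorem pow_div_exp_le_factorial (n : ℕ) : ((n : ℝ) / Real.exp 1) ^ n ≤ n.factorial := by
  have h := Real.pow_div_factorial_le_exp (n : ℝ) (by positivity) n
  rw [div_pow, ← Real.exp_nat_mul, mul_one, div_le_iff₀ (Real.exp_pos _)]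
  rw [div_le_iff₀ (by positivity)] at h
  linarith

/-- Induction using e ≤ (1 + 1/n)^(n+1). The loss against Stirling is polynomial in n, hence
harmless next to c^n. -/
theorem factorial_le_mul_pow_div_exp {n : ℕ} (hn : 1 ≤ n) :
    (n.factorial : ℝ) ≤ Real.exp 1 * n * ((n : ℝ) / Real.exp 1) ^ n := by
  induction n, hn using Nat.le_induction with
  | base => simp
  | succ n hn ih =>
    have hn0 : (0 : ℝ) < n := by exact_mod_cast hn
    have key : Real.exp 1 * (n : ℝ) ^ (n + 1) ≤ ((n : ℝ) + 1) ^ (n + 1) := by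
      have h1 : 1 / ((n : ℝ) + 1) ≤ Real.log (1 + 1 / n) := by
        have := Real.one_sub_inv_le_log_of_pos (show 0 < 1 + 1 / (n : ℝ) by positivity)
        refine le_trans (le_of_eq ?_) this
        field_simp
        ring
      have h2 : Real.exp 1 ≤ (1 + 1 / (n : ℝ)) ^ (n + 1) := by
        rw [← Real.exp_log (show 0 < 1 + 1 / (n : ℝ) by positivity), ← Real.exp_nat_mul]
        apply Real.exp_le_exp.2
        rw [div_le_iff₀ (by positivity)] at h1
        push_cast
        linarith
      calc Real.exp 1 * (n : ℝ) ^ (n + 1) ≤ (1 + 1 / (n : ℝ)) ^ (n + 1) * (n : ℝ) ^ (n + 1) := by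
            gcongr
        _ = _ := by
            rw [← mul_pow]
            congr 1
            field_simp
    have he := Real.exp_pos 1
    calc ((n + 1).factorial : ℝ) = (n + 1) * n.factorial := by
          rw [Nat.factorial_succ]; push_cast; ring
      _ ≤ (n + 1) * (Real.exp 1 * n * ((n : ℝ) / Real.exp 1) ^ n) := by gcongr
      _ = (n + 1) * (Real.exp 1 * (n : ℝ) ^ (n + 1)) / Real.exp 1 ^ n := by
          rw [div_pow]; field_simp; ring
      _ ≤ (n + 1) * ((n : ℝ) + 1) ^ (n + 1) / Real.exp 1 ^ n := by gcongr
      _ = _ := by push_cast; rw [div_pow, pow_succ (Real.exp 1)]; field_simp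

theorem pow_lt_factorial_of_lt {z : ℝ} {n : ℕ} (hz : 0 ≤ z) (hn : n ≠ 0)
    (h : z < 1 / Real.exp 1 * n) : z ^ n < n.factorial := by
  refine lt_of_lt_of_le (pow_lt_pow_left₀ ?_ hz hn) (pow_div_exp_le_factorial n)
  rwa [one_div_mul_eq_div] at h

/-- With n = s + 1, the quotient z^n/n! is at least c^n/(en), which tends to infinity; the remaining
factors are at least 1 for every τ ≥ 0. -/
theorem eventually_one_lt_hTilde {c : ℝ} (hc : 1 < c) :
    ∀ᶠ p : ℕ × ℝ in atTop ×ˢ 𝓝[≥] (0 : ℝ),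
      1 < hTilde p.1 p.2 (c * (1 / Real.exp 1 * ((p.1 : ℝ) + 1))) := by
  have hlim : Tendsto (fun n : ℕ => ((n : ℝ) * (c⁻¹) ^ n)) atTop (𝓝 0) :=
    tendsto_self_mul_const_pow_of_lt_one (by positivity) (inv_lt_one_of_one_lt₀ hc)
  have he := Real.exp_pos 1
  have h1 : ∀ᶠ s : ℕ in atTop, ((s + 1 : ℕ) : ℝ) * c⁻¹ ^ (s + 1) < (Real.exp 1)⁻¹ :=
    ((tendsto_add_atTop_iff_nat 1).2 hlim).eventually (gt_mem_nhds (by positivity))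
  have h2 : ∀ᶠ τ : ℝ in 𝓝[≥] (0 : ℝ), 0 ≤ τ := self_mem_nhdsWithin
  filter_upwards [h1.prod_mk h2] with ⟨s, τ⟩ ⟨h1, h2⟩
  simp only at h1 h2 ⊢
  have hp := Real.pi_pos
  have hf := factorial_le_mul_pow_div_exp (n := s + 1) (by omega)
  set n : ℕ := s + 1 with hn
  have hc0 : 0 < c := by linarith
  have hnc : ((s : ℝ) + 1) = n := by rw [hn]; push_cast; rfl
  have hn0 : (0 : ℝ) < n := by rw [← hnc]; positivity
  rw [hnc]
  unfold hTilde
  rw [← hn]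
  have e1 : 1 ≤ (1 + τ) ^ s := one_le_pow₀ (by linarith)
  have e4 : 1 ≤ 1 + 4 * (c * (1 / Real.exp 1 * n)) / Real.pi := by
    have : 0 ≤ 4 * (c * (1 / Real.exp 1 * n)) / Real.pi := by positivity
    linarith
  have e5 : (n.factorial : ℝ) < (c * (1 / Real.exp 1 * n)) ^ n := by
    refine hf.trans_lt ?_
    rw [mul_pow, one_div_mul_eq_div]
    refine mul_lt_mul_of_pos_right ?_ (by positivity)
    rw [inv_pow, ← div_eq_mul_inv, div_lt_iff₀ (by positivity)] at h1
    field_simp at h1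
    linarith
  have e6 : 1 < (1 + τ) ^ s * (c * (1 / Real.exp 1 * n)) ^ n / n.factorial := by
    rw [lt_div_iff₀ (by positivity)]
    nlinarith [(show (0 : ℝ) < n.factorial by positivity)]
  nlinarith

/-- For d between c and 1, the condition 1 + τ < d/c, which does not involve s, absorbs (1+τ)^s into
d^n. The geometric decay of d^n then beats the factor linear in n, so the limit is joint. -/
theorem eventually_hTilde_lt_one {c : ℝ} (hc0 : 0 < c) (hc : c < 1) :
    ∀ᶠ p : ℕ × ℝ in atTop ×ˢ 𝓝[≥] (0 : ℝ),
      hTilde p.1 p.2 (c * (1 / Real.exp 1 * ((p.1 : ℝ) + 1))) < 1 := by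
  obtain ⟨d, hd1, hd⟩ := exists_between hc
  have hd0 : 0 < d := hc0.trans hd1
  have he := Real.exp_pos 1
  have hp := Real.pi_pos
  set K : ℝ := 4 * (c / Real.exp 1) / Real.pi with hK
  have hlim : Tendsto (fun n : ℕ => d ^ n + K * ((n : ℝ) * d ^ n)) atTop (𝓝 (0 + K * 0)) :=
    (tendsto_pow_atTop_nhds_zero_of_lt_one hd0.le hd).add
      ((tendsto_self_mul_const_pow_of_lt_one hd0.le hd).const_mul K)
  have h1 : ∀ᶠ s : ℕ in atTop, d ^ (s + 1) + K * (((s + 1 : ℕ) : ℝ) * d ^ (s + 1)) < 1 :=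
    ((tendsto_add_atTop_iff_nat 1).2 hlim).eventually (gt_mem_nhds (by norm_num))
  have h2 : ∀ᶠ τ : ℝ in 𝓝[≥] (0 : ℝ), 0 ≤ τ := self_mem_nhdsWithin
  have h3 : ∀ᶠ τ : ℝ in 𝓝[≥] (0 : ℝ), τ < d / c - 1 :=
    nhdsWithin_le_nhds (gt_mem_nhds (by rw [sub_pos, lt_div_iff₀ hc0]; linarith))
  filter_upwards [h1.prod_mk (h2.and h3)] with ⟨s, τ⟩ ⟨h1, h2, h3⟩
  simp only at h1 h2 h3 ⊢
  have hf := pow_div_exp_le_factorial (s + 1)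
  set n : ℕ := s + 1 with hn
  have hnc : ((s : ℝ) + 1) = n := by rw [hn]; push_cast; rfl
  have hn0 : (0 : ℝ) < n := by rw [← hnc]; positivity
  rw [hnc]
  unfold hTilde
  rw [← hn]
  refine lt_of_le_of_lt ?_ h1
  have e1 : (1 + τ) ^ s ≤ (d / c) ^ n := by
    calc (1 + τ) ^ s ≤ (1 + τ) ^ n := pow_le_pow_right₀ (by linarith) (by omega)
      _ ≤ _ := by gcongr; linarith
  have e2 : (1 + τ) ^ s * (c * (1 / Real.exp 1 * n)) ^ n / n.factorial ≤ d ^ n := by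
    rw [div_le_iff₀ (by positivity)]
    calc (1 + τ) ^ s * (c * (1 / Real.exp 1 * n)) ^ n
        ≤ (d / c) ^ n * (c * (1 / Real.exp 1 * n)) ^ n := by gcongr
      _ = d ^ n * ((n : ℝ) / Real.exp 1) ^ n := by
          rw [← mul_pow, ← mul_pow]; congr 1; field_simp
      _ ≤ _ := by gcongr
  calc _ ≤ d ^ n * (1 + 4 * (c * (1 / Real.exp 1 * n)) / Real.pi) := by gcongr
    _ = _ := by rw [hK]; field_simp

theorem isEquivalent_HTilde :
    Asymptotics.IsEquivalent (atTop ×ˢ 𝓝[≥] (0 : ℝ))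
      (fun p : ℕ × ℝ => HTilde p.1 p.2 1)
      (fun p : ℕ × ℝ => 1 / Real.exp 1 * ((p.1 : ℝ) + 1)) := by
  have he := Real.exp_pos 1
  rw [Asymptotics.isEquivalent_iff_tendsto_one
    (Eventually.of_forall fun p => by positivity)]
  have h2 : ∀ᶠ p : ℕ × ℝ in atTop ×ˢ 𝓝[≥] (0 : ℝ), 0 ≤ p.2 :=
    tendsto_snd.eventually (self_mem_nhdsWithin : ∀ᶠ τ : ℝ in 𝓝[≥] (0 : ℝ), 0 ≤ τ)
  rw [tendsto_order]
  constructor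
  · intro a ha
    -- The maximum with 0 keeps c positive even when a is negative.
    obtain ⟨c, hc1, hc⟩ := exists_between (max_lt ha one_pos)
    rw [max_lt_iff] at hc1
    filter_upwards [h2, eventually_hTilde_lt_one hc1.2 hc] with p hp hlt
    rw [← lt_HTilde_iff _ hp (by have := hc1.2; positivity)] at hlt
    rw [Pi.div_apply, lt_div_iff₀ (by positivity)]
    refine lt_trans ?_ hlt
    gcongr
    exact hc1.1
  · intro c hc
    filter_upwards [h2, eventually_one_lt_hTilde hc] with p hp hlt
    rw [← HTilde_lt_iff _ hp (by positivity)] at hlt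
    rwa [Pi.div_apply, div_lt_iff₀ (by positivity)]

/-! ### Cauchy–Schwarz and Wirtinger inequalities on intervals -/

/-- The Cauchy–Schwarz inequality for continuous functions on an interval. -/
theorem sq_integral_mul_le {p q : ℝ → ℝ} (hp : Continuous p) (hq : Continuous q) (a b : ℝ) :
    (∫ t in a..b, p t * q t) ^ 2 ≤ |∫ t in a..b, p t ^ 2| * |∫ t in a..b, q t ^ 2| := by
  wlog hab : a ≤ b generalizing a b
  · have := this b a (le_of_not_ge hab)
    rw [intervalIntegral.integral_symm a b, intervalIntegral.integral_symm a b,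
      intervalIntegral.integral_symm a b] at this
    simpa using this
  rw [abs_of_nonneg (intervalIntegral.integral_nonneg hab fun t _ => sq_nonneg _),
    abs_of_nonneg (intervalIntegral.integral_nonneg hab fun t _ => sq_nonneg _)]
  -- The quadratic x ↦ ∫ (x p + q)² is nonnegative, so its discriminant is not positive.
  have key : ∀ x : ℝ, 0 ≤ (∫ t in a..b, p t ^ 2) * (x * x) + (2 * ∫ t in a..b, p t * q t) * x
      + ∫ t in a..b, q t ^ 2 := by
    intro x
    have h : 0 ≤ ∫ t in a..b, (x * p t + q t) ^ 2 :=
      intervalIntegral.integral_nonneg hab fun t _ => sq_nonneg _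
    have h2 : ∫ t in a..b, (x * p t + q t) ^ 2 =
        ∫ t in a..b, ((x * x) * p t ^ 2 + (2 * x) * (p t * q t) + q t ^ 2) := by
      congr 1; ext t; ring
    rw [h2, intervalIntegral.integral_add, intervalIntegral.integral_add,
      intervalIntegral.integral_const_mul, intervalIntegral.integral_const_mul] at h
    · linarith
    all_goals exact Continuous.intervalIntegrable (by fun_prop) _ _
  have := discrim_le_zero key
  rw [discrim] at this
  nlinarith

theorem sq_norm_integral_le {g : ℝ → ℂ} (hg : Continuous g) {a b : ℝ} (hab : a ≤ b) :
    (∫ t in a..b, ‖g t‖) ^ 2 ≤ (b - a) * ∫ t in a..b, ‖g t‖ ^ 2 := by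
  have := sq_integral_mul_le (p := fun _ => 1) (q := fun t => ‖g t‖) continuous_const hg.norm a b
  simp only [one_mul, one_pow, intervalIntegral.integral_const, smul_eq_mul, mul_one] at this
  rwa [abs_of_nonneg (sub_nonneg.2 hab),
    abs_of_nonneg (intervalIntegral.integral_nonneg hab fun t _ => sq_nonneg _)] at this

/-- Riccati argument: p = k tan(k(a+d-t)) solves p' = -(k² + p²), so completing the square gives
(p|u|²)' ≤ |u'|² - k²|u|². The boundary terms vanish because u(a) = 0 and p(a+d) = 0; the condition
kd < π/2 keeps the tangent finite. -/
theorem wirtinger_aux {u : ℝ → ℂ} (hu : ContDiff ℝ 1 u) {a d k : ℝ} (hd : 0 ≤ d) (h0 : u a = 0)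
    (hk : 0 ≤ k) (hkd : k * d < Real.pi / 2) :
    k ^ 2 * ∫ t in a..(a + d), ‖u t‖ ^ 2 ≤ ∫ t in a..(a + d), ‖deriv u t‖ ^ 2 := by
  have had : a ≤ a + d := by linarith
  have hdu : Continuous (deriv u) := hu.continuous_deriv_one
  set p : ℝ → ℝ := fun t => k * Real.tan (k * (a + d - t)) with hp
  have hcos : ∀ t ∈ Icc a (a + d), 0 < Real.cos (k * (a + d - t)) := by
    intro t ht
    apply Real.cos_pos_of_mem_Ioo
    have h1 : 0 ≤ k * (a + d - t) := mul_nonneg hk (by linarith [ht.2])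
    have h2 : k * (a + d - t) ≤ k * d := by gcongr; linarith [ht.1]
    constructor <;> linarith [Real.pi_pos]
  have hpd : ∀ t ∈ Icc a (a + d), HasDerivAt p (-(k ^ 2 + p t ^ 2)) t := by
    intro t ht
    have h1 := (Real.hasDerivAt_tan (hcos t ht).ne').comp t
      (((hasDerivAt_id t).const_sub (a + d)).const_mul k)
    refine (h1.const_mul k).congr_deriv ?_
    simp only [hp, Real.tan_eq_sin_div_cos]
    have := (hcos t ht).ne'
    have h3 := Real.sin_sq_add_cos_sq (k * (a + d - t))
    field_simp
    linear_combination (k ^ 2) * h3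
  have hsq : ∀ t, HasDerivAt (fun t => ‖u t‖ ^ 2) (2 * inner ℝ (u t) (deriv u t)) t := fun t =>
    (hu.differentiable (by norm_num) t).hasDerivAt.norm_sq
  have hpc : ContinuousOn p (Icc a (a + d)) := fun t ht => (hpd t ht).continuousAt.continuousWithinAt
  have hder : ∀ t ∈ uIcc a (a + d), HasDerivAt (fun t => p t * ‖u t‖ ^ 2)
      (-(k ^ 2 + p t ^ 2) * ‖u t‖ ^ 2 + p t * (2 * inner ℝ (u t) (deriv u t))) t := by
    intro t ht
    rw [uIcc_of_le had] at ht
    exact (hpd t ht).mul (hsq t)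
  have hcu : Continuous u := hu.continuous
  have hint : ContinuousOn (fun t => -(k ^ 2 + p t ^ 2) * ‖u t‖ ^ 2 +
      p t * (2 * inner ℝ (u t) (deriv u t))) (uIcc a (a + d)) := by
    rw [uIcc_of_le had]
    fun_prop
  have hftc := intervalIntegral.integral_eq_sub_of_hasDerivAt hder hint.intervalIntegrable
  have hend : p (a + d) = 0 := by simp [hp]
  rw [hend, h0] at hftc
  simp only [zero_mul, norm_zero, ne_eq, OfNat.ofNat_ne_zero, not_false_eq_true, zero_pow,
    mul_zero, sub_zero] at hftc
  have hmono : ∫ t in a..(a + d), (-(k ^ 2 + p t ^ 2) * ‖u t‖ ^ 2 +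
      p t * (2 * inner ℝ (u t) (deriv u t))) ≤
      ∫ t in a..(a + d), (‖deriv u t‖ ^ 2 - k ^ 2 * ‖u t‖ ^ 2) := by
    refine intervalIntegral.integral_mono_on had hint.intervalIntegrable
      (Continuous.intervalIntegrable (by fun_prop) _ _) fun t _ => ?_
    have h1 := abs_le.1 (abs_real_inner_le_norm (u t) (deriv u t))
    have h2 : p t * inner ℝ (u t) (deriv u t) ≤ |p t| * (‖u t‖ * ‖deriv u t‖) := by
      refine (le_abs_self _).trans ?_
      rw [abs_mul]
      gcongr
      exact abs_real_inner_le_norm _ _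
    nlinarith [sq_nonneg (|p t| * ‖u t‖ - ‖deriv u t‖), sq_abs (p t)]
  rw [hftc, intervalIntegral.integral_sub, intervalIntegral.integral_const_mul] at hmono
  · linarith
  all_goals exact Continuous.intervalIntegrable (by fun_prop) _ _

/-- Wirtinger's inequality for a function which vanishes at the left end point. -/
theorem wirtinger_right {u : ℝ → ℂ} (hu : ContDiff ℝ 1 u) {a d δ : ℝ} (hd : 0 ≤ d) (hδ : d ≤ δ)
    (h0 : u a = 0) :
    ∫ t in a..(a + d), ‖u t‖ ^ 2 ≤
      (2 * δ / Real.pi) ^ 2 * ∫ t in a..(a + d), ‖deriv u t‖ ^ 2 := by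
  rcases hd.eq_or_lt with rfl | hd0
  · simp
  have hp := Real.pi_pos
  have hI : 0 ≤ ∫ t in a..(a + d), ‖deriv u t‖ ^ 2 :=
    intervalIntegral.integral_nonneg (by linarith) fun t _ => sq_nonneg _
  -- At the sharp value k = π/(2d) the tangent is singular at a, so this value is only reached as a
  -- limit from below.
  have h1 : ∀ᶠ k in 𝓝[<] (Real.pi / (2 * d)),
      k ^ 2 * ∫ t in a..(a + d), ‖u t‖ ^ 2 ≤ ∫ t in a..(a + d), ‖deriv u t‖ ^ 2 := by
    have h2 : ∀ᶠ k in 𝓝[<] (Real.pi / (2 * d)), 0 < k :=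
      nhdsWithin_le_nhds (lt_mem_nhds (by positivity))
    filter_upwards [h2, self_mem_nhdsWithin] with k hk hk2
    refine wirtinger_aux hu hd h0 hk.le ?_
    rw [mem_Iio, lt_div_iff₀ (by positivity)] at hk2
    linarith
  have h3 : (Real.pi / (2 * d)) ^ 2 * ∫ t in a..(a + d), ‖u t‖ ^ 2 ≤
      ∫ t in a..(a + d), ‖deriv u t‖ ^ 2 := by
    refine le_of_tendsto (Tendsto.mono_left ?_ nhdsWithin_le_nhds) h1
    exact Continuous.tendsto (f := fun k : ℝ => k ^ 2 * ∫ t in a..(a + d), ‖u t‖ ^ 2)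
      (by fun_prop) _
  have hU : 0 ≤ ∫ t in a..(a + d), ‖u t‖ ^ 2 :=
    intervalIntegral.integral_nonneg (by linarith) fun t _ => sq_nonneg _
  calc ∫ t in a..(a + d), ‖u t‖ ^ 2
      = (2 * d / Real.pi) ^ 2 * ((Real.pi / (2 * d)) ^ 2 * ∫ t in a..(a + d), ‖u t‖ ^ 2) := by
        field_simp
    _ ≤ (2 * δ / Real.pi) ^ 2 * ∫ t in a..(a + d), ‖deriv u t‖ ^ 2 := by
        gcongr

/-- Wirtinger's inequality for the deviation of a function from its value at an inner point. -/
theorem wirtinger_Icc {u : ℝ → ℂ} (hu : ContDiff ℝ 1 u) {a b c δ : ℝ} (hac : a ≤ c) (hcb : c ≤ b)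
    (ha : c - a ≤ δ) (hb : b - c ≤ δ) :
    ∫ t in Icc a b, ‖u t - u c‖ ^ 2 ≤ (2 * δ / Real.pi) ^ 2 * ∫ t in Icc a b, ‖deriv u t‖ ^ 2 := by
  have hdu : Continuous (deriv u) := hu.continuous_deriv_one
  have hcu : Continuous u := hu.continuous
  rw [integral_Icc_eq_integral_Ioc, integral_Icc_eq_integral_Ioc,
    ← intervalIntegral.integral_of_le (hac.trans hcb),
    ← intervalIntegral.integral_of_le (hac.trans hcb)]
  have hR := wirtinger_right (u := fun t => u t - u c) (by fun_prop) (a := c) (d := b - c)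
    (by linarith) hb (by simp)
  -- The part to the left of c is reflected, so that c becomes a left end point.
  have hL := wirtinger_right (u := fun t => u (-t) - u c) (by fun_prop) (a := -c) (d := c - a)
    (by linarith) ha (by simp)
  have hdL : ∀ t, ‖deriv (fun t => u (-t) - u c) t‖ = ‖deriv u (-t)‖ := by
    intro t
    rw [deriv_sub_const, deriv_comp_neg, norm_neg]
  simp only [deriv_sub_const_fun, add_sub_cancel] at hR
  simp only [hdL] at hL
  rw [intervalIntegral.integral_comp_neg (fun t => ‖u t - u c‖ ^ 2),
    intervalIntegral.integral_comp_neg (fun t => ‖deriv u t‖ ^ 2)] at hL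
  simp only [neg_neg, neg_add_rev, neg_sub] at hL
  rw [show a - c + c = a by ring] at hL
  rw [← intervalIntegral.integral_add_adjacent_intervals (b := c),
    ← intervalIntegral.integral_add_adjacent_intervals (a := a) (b := c) (c := b)
      (f := fun t => ‖deriv u t‖ ^ 2)]
  · linarith
  all_goals exact Continuous.intervalIntegrable (by fun_prop) _ _

/-! ### The Taylor remainder in L² -/

/-- The Taylor polynomial of degree `s`. -/
def taylorSum (F : ℝ → ℂ) (s : ℕ) (c t : ℝ) : ℂ :=
  ∑ m ∈ Finset.range (s + 1), (((t - c) ^ m / (m.factorial : ℝ) : ℝ) : ℂ) * iteratedDeriv m F c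

theorem sub_taylorSum_eq {F : ℝ → ℂ} (hF : ∀ n : ℕ, ContDiff ℝ n F) (s : ℕ) (c t : ℝ) :
    F t - taylorSum F s c t =
      ∫ r in c..t, ((t - r) ^ s / (s.factorial : ℝ)) • iteratedDeriv (s + 1) F r := by
  rcases eq_or_ne c t with rfl | hne
  · simp [taylorSum, Finset.sum_range_succ']
  have hud := uniqueDiffOn_uIcc hne
  have h := taylor_integral_remainder (f := F) (x := t) (x₀ := c) (n := s) (hF _).contDiffOn
  have e : ∀ k : ℕ, ∀ r ∈ uIcc c t, iteratedDerivWithin k F (uIcc c t) r = iteratedDeriv k F r :=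
    fun k r hr => iteratedDerivWithin_eq_iteratedDeriv hud (hF k).contDiffAt hr
  rw [taylor_within_apply] at h
  have h2 : ∫ r in c..t, ((t - r) ^ s / (s.factorial : ℝ)) • iteratedDerivWithin (s + 1) F (uIcc c t) r
      = ∫ r in c..t, ((t - r) ^ s / (s.factorial : ℝ)) • iteratedDeriv (s + 1) F r :=
    intervalIntegral.integral_congr fun r hr => congrArg _ (e (s + 1) r hr)
  rw [← h2, ← h, taylorSum]
  congr 1
  refine Finset.sum_congr rfl fun k _ => ?_
  rw [e k c left_mem_uIcc, Complex.real_smul, div_eq_inv_mul]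

/-- Cauchy–Schwarz in the integral form of the remainder; the constant is the integral of
(t-r)^(2s)/(s!)² between c and t. -/
theorem norm_sub_taylorSum_sq_le {F : ℝ → ℂ} (hF : ∀ n : ℕ, ContDiff ℝ n F) (s : ℕ) {a b c t : ℝ}
    (hc : c ∈ Icc a b) (ht : t ∈ Icc a b) :
    ‖F t - taylorSum F s c t‖ ^ 2 ≤ |t - c| ^ (2 * s + 1) / ((2 * s + 1) * (s.factorial : ℝ) ^ 2) *
      ∫ r in a..b, ‖iteratedDeriv (s + 1) F r‖ ^ 2 := by
  have hcont : Continuous (iteratedDeriv (s + 1) F) :=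
    (hF (s + 1)).continuous_iteratedDeriv _ le_rfl
  have hab : a ≤ b := hc.1.trans hc.2
  rw [sub_taylorSum_eq hF]
  have h1 : ‖∫ r in c..t, ((t - r) ^ s / (s.factorial : ℝ)) • iteratedDeriv (s + 1) F r‖ ^ 2 ≤
      (∫ r in c..t, |(t - r) ^ s / (s.factorial : ℝ)| * ‖iteratedDeriv (s + 1) F r‖) ^ 2 := by
    rw [← sq_abs (∫ r in c..t, _)]
    gcongr
    refine (intervalIntegral.norm_integral_le_abs_integral_norm).trans (le_of_eq ?_)
    simp only [norm_smul, Real.norm_eq_abs]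
  have h2 := sq_integral_mul_le (p := fun r => |(t - r) ^ s / (s.factorial : ℝ)|)
    (q := fun r => ‖iteratedDeriv (s + 1) F r‖) (by fun_prop) (by fun_prop) c t
  refine (h1.trans h2).trans ?_
  have h3 : |∫ r in c..t, |(t - r) ^ s / (s.factorial : ℝ)| ^ 2| =
      |t - c| ^ (2 * s + 1) / ((2 * s + 1) * (s.factorial : ℝ) ^ 2) := by
    have : ∀ r : ℝ, |(t - r) ^ s / (s.factorial : ℝ)| ^ 2 =
        (t - r) ^ (2 * s) / (s.factorial : ℝ) ^ 2 := by
      intro r; rw [sq_abs, div_pow, ← pow_mul, mul_comm s 2]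
    simp_rw [this]
    rw [intervalIntegral.integral_div, intervalIntegral.integral_comp_sub_left
      (fun r => r ^ (2 * s)), integral_pow, abs_div, abs_div]
    simp only [sub_self, ne_eq, Nat.add_eq_zero_iff, one_ne_zero, and_false, not_false_eq_true,
      zero_pow, sub_zero, abs_pow]
    rw [Nat.abs_cast, div_div]
    congr 2
    rw [abs_of_nonneg (by positivity)]
    push_cast
    rfl
  have h4 : |∫ r in c..t, ‖iteratedDeriv (s + 1) F r‖ ^ 2| ≤
      ∫ r in a..b, ‖iteratedDeriv (s + 1) F r‖ ^ 2 := by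
    rw [← abs_of_nonneg (intervalIntegral.integral_nonneg hab fun t _ => sq_nonneg
      ‖iteratedDeriv (s + 1) F t‖)]
    refine intervalIntegral.abs_integral_mono_interval ?_ ?_ ?_
    · rw [uIoc_of_le hab]
      intro r hr
      rw [mem_uIoc] at hr
      rcases hr with hr | hr
      · exact ⟨hc.1.trans_lt hr.1, hr.2.trans ht.2⟩
      · exact ⟨ht.1.trans_lt hr.1, hr.2.trans hc.2⟩
    · exact Eventually.of_forall fun r => sq_nonneg _
    · exact Continuous.intervalIntegrable (by fun_prop) _ _
  rw [h3]
  gcongr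

/-- The `L²` bound for the remainder of Taylor's formula at an inner point of an interval. -/
theorem integral_norm_sub_taylorSum_sq_le {F : ℝ → ℂ} (hF : ∀ n : ℕ, ContDiff ℝ n F) (s : ℕ)
    {a b c δ : ℝ} (hac : a ≤ c) (hcb : c ≤ b) (ha : c - a ≤ δ) (hb : b - c ≤ δ) :
    ∫ t in Icc a b, ‖F t - taylorSum F s c t‖ ^ 2 ≤
      (δ ^ (s + 1) / ((s + 1).factorial : ℝ)) ^ 2 *
        ∫ t in Icc a b, ‖iteratedDeriv (s + 1) F t‖ ^ 2 := by
  have hab := hac.trans hcb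
  have hcF : Continuous F := (hF 0).continuous
  have hδ : 0 ≤ δ := by linarith
  have hT : Continuous (taylorSum F s c) := by unfold taylorSum; fun_prop
  rw [integral_Icc_eq_integral_Ioc, integral_Icc_eq_integral_Ioc,
    ← intervalIntegral.integral_of_le hab, ← intervalIntegral.integral_of_le hab]
  set G := ∫ r in a..b, ‖iteratedDeriv (s + 1) F r‖ ^ 2 with hG
  have hG0 : 0 ≤ G := intervalIntegral.integral_nonneg hab fun t _ => sq_nonneg _
  set q : ℝ := (2 * s + 1) * (s.factorial : ℝ) ^ 2 with hq
  have hq0 : 0 < q := by positivity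
  -- Each side of c contributes at most δ^(2s+2)/(2s+2).
  have hpow : ∫ t in a..b, |t - c| ^ (2 * s + 1) ≤ δ ^ (2 * s + 2) / (s + 1) := by
    have hl : ∫ t in a..c, |t - c| ^ (2 * s + 1) = (c - a) ^ (2 * s + 2) / (2 * s + 2) := by
      have : ∫ t in a..c, |t - c| ^ (2 * s + 1) = ∫ t in a..c, (c - t) ^ (2 * s + 1) := by
        refine intervalIntegral.integral_congr fun t ht => ?_
        rw [uIcc_of_le hac] at ht
        rw [abs_of_nonpos (by linarith [ht.2]), neg_sub]
      rw [this, intervalIntegral.integral_comp_sub_left (fun r => r ^ (2 * s + 1)), integral_pow]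
      simp
      ring
    have hr : ∫ t in c..b, |t - c| ^ (2 * s + 1) = (b - c) ^ (2 * s + 2) / (2 * s + 2) := by
      have : ∫ t in c..b, |t - c| ^ (2 * s + 1) = ∫ t in c..b, (t - c) ^ (2 * s + 1) := by
        refine intervalIntegral.integral_congr fun t ht => ?_
        rw [uIcc_of_le hcb] at ht
        rw [abs_of_nonneg (by linarith [ht.1])]
      rw [this, intervalIntegral.integral_comp_sub_right (fun r => r ^ (2 * s + 1)), integral_pow]
      simp
      ring
    rw [← intervalIntegral.integral_add_adjacent_intervals (b := c)
      (Continuous.intervalIntegrable (by fun_prop) _ _)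
      (Continuous.intervalIntegrable (by fun_prop) _ _), hl, hr, ← add_div]
    have e1 : (c - a) ^ (2 * s + 2) ≤ δ ^ (2 * s + 2) := by gcongr
    have e2 : (b - c) ^ (2 * s + 2) ≤ δ ^ (2 * s + 2) := by gcongr
    rw [div_le_div_iff₀ (by positivity) (by positivity)]
    nlinarith [(show (0 : ℝ) ≤ s by positivity)]
  calc ∫ t in a..b, ‖F t - taylorSum F s c t‖ ^ 2
      ≤ ∫ t in a..b, |t - c| ^ (2 * s + 1) * (G / q) := by
        refine intervalIntegral.integral_mono_on hab
          (Continuous.intervalIntegrable (by fun_prop) _ _)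
          (Continuous.intervalIntegrable (by fun_prop) _ _) fun t ht => ?_
        refine (norm_sub_taylorSum_sq_le hF s ⟨hac, hcb⟩ ht).trans (le_of_eq ?_)
        rw [← hG, ← hq]
        ring
    _ = (∫ t in a..b, |t - c| ^ (2 * s + 1)) * (G / q) := by
        rw [intervalIntegral.integral_mul_const]
    _ ≤ δ ^ (2 * s + 2) / (s + 1) * (G / q) := by gcongr
    _ = δ ^ (2 * s + 2) / ((s + 1) * q) * G := by field_simp
    _ ≤ (δ ^ (s + 1) / ((s + 1).factorial : ℝ)) ^ 2 * G := by
        gcongr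
        -- What remains is (s+1)² ≤ (s+1)(2s+1).
        rw [div_pow, ← pow_mul, show (s + 1) * 2 = 2 * s + 2 by ring]
        gcongr
        rw [Nat.factorial_succ, hq]
        push_cast
        have : (0 : ℝ) ≤ s := by positivity
        rw [mul_pow, ← mul_assoc]
        gcongr
        nlinarith

/-! ### Divided differences and derivatives -/

/-- Iterated Rolle's theorem. -/
theorem exists_iteratedDeriv_eq_zero (n : ℕ) {g : ℝ → ℝ} (hg : ∀ k : ℕ, ContDiff ℝ k g) {α β : ℝ}
    {z : Fin (n + 1) → ℝ} (hz : StrictMono z) (hI : ∀ i, z i ∈ Icc α β) (h0 : ∀ i, g (z i) = 0) :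
    ∃ ξ ∈ Icc α β, iteratedDeriv n g ξ = 0 := by
  induction n generalizing g with
  | zero => exact ⟨z 0, hI 0, by simpa using h0 0⟩
  | succ n ih =>
    have h1 : ∀ i : Fin (n + 1), ∃ w ∈ Ioo (z i.castSucc) (z i.succ), deriv g w = 0 := fun i =>
      exists_deriv_eq_zero (hz Fin.castSucc_lt_succ) (hg 0).continuous.continuousOn
        (by rw [h0, h0])
    choose w hw hw0 using h1
    -- The new zeros lie in consecutive gaps between the old ones, so they are again increasing.
    have hmono : StrictMono w := by
      cases n with
      | zero => exact fun i j hij => by omega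
      | succ n =>
        rw [Fin.strictMono_iff_lt_succ]
        intro i
        have h2 := (hw i.castSucc).2
        have h3 := (hw i.succ).1
        rw [Fin.succ_castSucc] at h2
        exact h2.trans h3
    obtain ⟨ξ, hξ, h⟩ := ih (g := deriv g)
      (fun k => ((hg (k + 1)).of_le (by norm_cast)).deriv' ) hmono
      (fun i => ⟨(hI _).1.trans (hw i).1.le, (hw i).2.le.trans (hI _).2⟩) hw0
    exact ⟨ξ, hξ, by rw [iteratedDeriv_succ']; exact h⟩

theorem iteratedDeriv_polynomial_eval (P : Polynomial ℝ) (n : ℕ) :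
    iteratedDeriv n (fun t => P.eval t) = fun t => (Polynomial.derivative^[n] P).eval t := by
  induction n with
  | zero => simp
  | succ n ih =>
    ext t
    rw [iteratedDeriv_succ, ih, Polynomial.deriv, Function.iterate_succ_apply']

/-- The mean value theorem for divided differences. -/
theorem exists_iteratedDeriv_eq_dividedDifference {ι : Type*} [DecidableEq ι] {n : ℕ} {g : ℝ → ℝ}
    (hg : ∀ k : ℕ, ContDiff ℝ k g) {α β : ℝ} {S : Finset ι} (hS : S.card = n + 1) {v : ι → ℝ}
    (hv : InjOn v S) (hI : ∀ i ∈ S, v i ∈ Icc α β) :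
    ∃ ξ ∈ Icc α β, iteratedDeriv n g ξ =
      n.factorial * ∑ i ∈ S, g (v i) / ∏ j ∈ S.erase i, (v i - v j) := by
  -- Rolle is applied to g - P, which vanishes at the sorted nodes; the n-th derivative of P is
  -- constant, namely n! times the divided difference.
  set P := Lagrange.interpolate S v (fun i => g (v i)) with hP
  have hcard : (S.image v).card = n + 1 := by rw [Finset.card_image_of_injOn hv, hS]
  have hPs : ∀ k : ℕ, ContDiff ℝ k (fun t => P.eval t) := fun k => by
    simpa using P.contDiff_aeval (𝕜 := ℝ) (n := k)
  obtain ⟨ξ, hξ, h⟩ := exists_iteratedDeriv_eq_zero n (g := fun t => g t - P.eval t)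
    (fun k => (hg k).sub (hPs k)) (α := α) (β := β)
    ((S.image v).orderEmbOfFin hcard).strictMono (fun i => by
      obtain ⟨j, hj, hj2⟩ := Finset.mem_image.1 ((S.image v).orderEmbOfFin_mem hcard i)
      rw [← hj2]
      exact hI j hj) (fun i => by
      obtain ⟨j, hj, hj2⟩ := Finset.mem_image.1 ((S.image v).orderEmbOfFin_mem hcard i)
      rw [← hj2, hP, Lagrange.eval_interpolate_at_node _ hv hj, sub_self])
  refine ⟨ξ, hξ, ?_⟩
  rw [iteratedDeriv_fun_sub (hg n).contDiffAt (hPs n).contDiffAt, iteratedDeriv_polynomial_eval] at h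
  beta_reduce at h
  rw [Lagrange.eval_iterate_derivative_eq_sum hv
      (by rw [hP]; exact Lagrange.degree_interpolate_lt _ hv) (by omega)] at h
  rw [sub_eq_zero.1 h]
  congr 1
  refine Finset.sum_congr rfl fun i hi => ?_
  rw [hP, Lagrange.eval_interpolate_at_node _ hv hi, hS]
  simp

/-- Rolle's theorem needs real values; real parts of rotated functions give access to it. -/
theorem iteratedDeriv_re_mul {F : ℝ → ℂ} (hF : ∀ n : ℕ, ContDiff ℝ n F) (c : ℂ) (n : ℕ) :
    iteratedDeriv n (fun t => (c * F t).re) = fun t => (c * iteratedDeriv n F t).re := by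
  induction n with
  | zero => simp
  | succ n ih =>
    ext t
    rw [iteratedDeriv_succ, ih, iteratedDeriv_succ]
    have h1 := ((hF (n + 1)).differentiable_iteratedDeriv n (by norm_cast; omega) t).hasDerivAt
    exact (Complex.reCLM.hasFDerivAt.comp_hasDerivAt t (h1.const_mul c)).deriv

/-- After a rotation making the error real, the mean value theorem replaces the divided difference
by a derivative at some ξ in the interval. The error becomes an integral of the next derivative from
x to ξ, and Cauchy–Schwarz yields the small factor β - α. -/
theorem norm_divDiff_sub_sq_le {F : ℝ → ℂ} (hF : ∀ n : ℕ, ContDiff ℝ n F) {s : ℕ}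
    {y : Fin (s + 1) → ℝ} (hy : Function.Injective y) {α β x : ℝ} (hI : ∀ k, y k ∈ Icc α β)
    (hx : x ∈ Icc α β) (m : Fin (s + 1)) :
    ‖((m : ℕ).factorial : ℂ) * divDiff y m F - iteratedDeriv m F x‖ ^ 2 ≤
      (β - α) * ∫ t in Icc α β, ‖iteratedDeriv (m + 1) F t‖ ^ 2 := by
  have hαβ : α ≤ β := hx.1.trans hx.2
  have hcont : Continuous (iteratedDeriv (m + 1) F) :=
    (hF (m + 1)).continuous_iteratedDeriv _ le_rfl
  rw [integral_Icc_eq_integral_Ioc, ← intervalIntegral.integral_of_le hαβ]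
  refine le_trans ?_ (sq_norm_integral_le hcont hαβ)
  gcongr
  set z := ((m : ℕ).factorial : ℂ) * divDiff y m F - iteratedDeriv m F x with hz
  obtain ⟨c, hc, hcz⟩ : ∃ c : ℂ, ‖c‖ = 1 ∧ c * z = ‖z‖ := by
    rcases eq_or_ne z 0 with h0 | h0
    · exact ⟨1, by simp, by simp [h0]⟩
    · refine ⟨(starRingEnd ℂ) z / ‖z‖, by simp [h0], ?_⟩
      have : (‖z‖ : ℂ) ≠ 0 := by simpa using h0
      rw [div_mul_eq_mul_div, Complex.conj_mul']
      field_simp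
  obtain ⟨ξ, hξ, h⟩ := exists_iteratedDeriv_eq_dividedDifference (n := m)
    (g := fun t => (c * F t).re) (fun k => Complex.reCLM.contDiff.comp (contDiff_const.mul (hF k)))
    (S := Finset.Iic m) (by simp) hy.injOn (fun i _ => hI i)
  rw [iteratedDeriv_re_mul hF] at h
  have h2 : ((m : ℕ).factorial : ℝ) * ∑ i ∈ Finset.Iic m, (c * F (y i)).re /
      ∏ j ∈ (Finset.Iic m).erase i, (y i - y j) =
      (c * (((m : ℕ).factorial : ℂ) * divDiff y m F)).re := by
    rw [divDiff, mul_left_comm,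
      show (((m : ℕ).factorial : ℂ)) = (((m : ℕ).factorial : ℝ) : ℂ) by simp,
      Complex.re_ofReal_mul, Finset.mul_sum (a := c), Complex.re_sum]
    congr 1
    refine Finset.sum_congr rfl fun i _ => ?_
    rw [← mul_div_assoc, ← Complex.div_ofReal_re]
    push_cast
    rfl
  have h3 : ‖z‖ = (c * (iteratedDeriv m F ξ - iteratedDeriv m F x)).re := by
    have : ‖z‖ = (c * z).re := by rw [hcz, Complex.ofReal_re]
    rw [this, hz, mul_sub, mul_sub, Complex.sub_re, Complex.sub_re, ← h2, ← h]
  have h4 : ∫ t in x..ξ, iteratedDeriv (m + 1) F t = iteratedDeriv m F ξ - iteratedDeriv m F x := by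
    refine intervalIntegral.integral_eq_sub_of_hasDerivAt (fun t _ => ?_)
      (hcont.intervalIntegrable _ _)
    rw [iteratedDeriv_succ]
    exact ((hF (m + 1)).differentiable_iteratedDeriv m (by norm_cast; omega) t).hasDerivAt
  calc ‖z‖ ≤ ‖c * (iteratedDeriv m F ξ - iteratedDeriv m F x)‖ := by
        rw [h3]; exact Complex.re_le_norm _
    _ = ‖∫ t in x..ξ, iteratedDeriv (m + 1) F t‖ := by rw [norm_mul, hc, one_mul, h4]
    _ ≤ |∫ t in x..ξ, ‖iteratedDeriv (m + 1) F t‖| :=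
        intervalIntegral.norm_integral_le_abs_integral_norm
    _ ≤ |∫ t in α..β, ‖iteratedDeriv (m + 1) F t‖| := by
        refine intervalIntegral.abs_integral_mono_interval ?_ ?_ ?_
        · rw [uIoc_of_le hαβ]
          intro r hr
          rw [mem_uIoc] at hr
          rcases hr with hr | hr
          · exact ⟨hx.1.trans_lt hr.1, hr.2.trans hξ.2⟩
          · exact ⟨hξ.1.trans_lt hr.1, hr.2.trans hx.2⟩
        · exact Eventually.of_forall fun r => norm_nonneg _
        · exact hcont.norm.intervalIntegrable _ _
    _ = _ := abs_of_nonneg (intervalIntegral.integral_nonneg hαβ fun t _ => norm_nonneg _)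

/-! ### Voronoi cells on the line -/

theorem self_mem_voronoi {I : Type*} (x : I → ℝ) (n : I) : x n ∈ voronoi x n := by
  intro k; simp

/-- Squaring makes the conditions affine in t. Hence cells are convex, and two cells meet at most in
the midpoint of their centres. -/
theorem mem_voronoi_iff {I : Type*} {x : I → ℝ} {n : I} {t : ℝ} :
    t ∈ voronoi x n ↔ ∀ k, 2 * t * (x k - x n) ≤ x k ^ 2 - x n ^ 2 := by
  refine forall_congr' fun k => ?_
  rw [← sq_le_sq]
  constructor <;> intro h <;> nlinarith

theorem isClosed_voronoi {I : Type*} (x : I → ℝ) (n : I) : IsClosed (voronoi x n) := by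
  unfold voronoi
  rw [show {t | ∀ k, |t - x n| ≤ |t - x k|} = ⋂ k, {t | |t - x n| ≤ |t - x k|} by ext; simp]
  exact isClosed_iInter fun k => isClosed_le (by fun_prop) (by fun_prop)

theorem convex_voronoi {I : Type*} (x : I → ℝ) (n : I) : Convex ℝ (voronoi x n) := by
  intro t ht u hu a b ha hb hab
  rw [mem_voronoi_iff] at ht hu ⊢
  intro k
  have h1 := mul_le_mul_of_nonneg_left (ht k) ha
  have h2 := mul_le_mul_of_nonneg_left (hu k) hb
  simp only [smul_eq_mul]
  have : x k ^ 2 - x n ^ 2 = a * (x k ^ 2 - x n ^ 2) + b * (x k ^ 2 - x n ^ 2) := by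
    rw [← add_mul, hab, one_mul]
  rw [this]
  linarith

theorem abs_sub_le_of_mem_voronoi {I : Type*} {x : I → ℝ} {δ : ℝ} (hδ0 : 0 ≤ δ)
    (hδ : density x = ENNReal.ofReal δ) {n : I} {t : ℝ} (ht : t ∈ voronoi x n) :
    |t - x n| ≤ δ := by
  rw [← ENNReal.ofReal_le_ofReal_iff hδ0, ← hδ]
  exact le_trans (le_iInf fun k => ENNReal.ofReal_le_ofReal (ht k))
    (le_iSup (fun t : ℝ => ⨅ n, ENNReal.ofReal |t - x n|) t)

theorem voronoi_eq_Icc {I : Type*} {x : I → ℝ} {δ : ℝ} (hδ0 : 0 ≤ δ)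
    (hδ : density x = ENNReal.ofReal δ) (n : I) :
    ∃ a b, voronoi x n = Icc a b ∧ a ≤ x n ∧ x n ≤ b ∧ x n - a ≤ δ ∧ b - x n ≤ δ := by
  have hne : (voronoi x n).Nonempty := ⟨_, self_mem_voronoi x n⟩
  have hsub : voronoi x n ⊆ Icc (x n - δ) (x n + δ) := fun t ht => by
    have := abs_le.1 (abs_sub_le_of_mem_voronoi hδ0 hδ ht)
    constructor <;> linarith [this.1, this.2]
  have hc : IsCompact (voronoi x n) :=
    isCompact_Icc.of_isClosed_subset (isClosed_voronoi x n) hsub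
  have h := eq_Icc_of_connected_compact ⟨hne, (convex_voronoi x n).isPreconnected⟩ hc
  have hx := self_mem_voronoi x n
  refine ⟨_, _, h, ?_, ?_, ?_, ?_⟩
  · rw [h] at hx; exact hx.1
  · rw [h] at hx; exact hx.2
  · have := (hsub (hc.sInf_mem hne)).1
    linarith
  · have := (hsub (hc.sSup_mem hne)).2
    linarith

theorem aedisjoint_voronoi {I : Type*} {x : I → ℝ} (hx : Function.Injective x) :
    Pairwise (Function.onFun (AEDisjoint volume) (voronoi x)) := by
  intro n k hnk
  refine measure_mono_null (t := {(x n + x k) / 2}) ?_ (measure_singleton _)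
  rintro t ⟨h1, h2⟩
  rw [mem_voronoi_iff] at h1 h2
  have h3 := h1 k
  have h4 := h2 n
  have hne : x k - x n ≠ 0 := sub_ne_zero.2 fun h => hnk (hx h).symm
  rw [mem_singleton_iff]
  apply mul_right_cancel₀ hne
  linarith

theorem hasSum_integral_voronoi {I : Type*} [Countable I] {x : I → ℝ} (hx : Function.Injective x)
    (hcover : ⋃ n, voronoi x n = univ) {f : ℝ → ℝ} (hf : Integrable f) :
    HasSum (fun n => ∫ t in voronoi x n, f t) (∫ t, f t) := by
  have h := hasSum_integral_iUnion_ae (μ := volume) (f := f)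
    (fun n => (isClosed_voronoi x n).measurableSet.nullMeasurableSet) (aedisjoint_voronoi hx)
    hf.integrableOn
  rwa [hcover, setIntegral_univ] at h

/-! ### Summing cell estimates -/

/-- Control by all convex combinations of two nonnegative bounds gives the triangle inequality. -/
theorem le_sq_add_of_forall {X a b : ℝ} (ha : 0 ≤ a) (hb : 0 ≤ b)
    (h : ∀ t > 0, X ≤ (1 + t) * a ^ 2 + (1 + t⁻¹) * b ^ 2) : X ≤ (a + b) ^ 2 := by
  have key : ∀ ε > 0, X ≤ (a + ε + (b + ε)) ^ 2 := by
    intro ε hε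
    -- The optimal parameter is b/a; the shift by ε covers vanishing a or b.
    have h1 := h ((b + ε) / (a + ε)) (by positivity)
    refine h1.trans ?_
    calc _ ≤ (1 + (b + ε) / (a + ε)) * (a + ε) ^ 2 + (1 + ((b + ε) / (a + ε))⁻¹) * (b + ε) ^ 2 := by
          gcongr <;> linarith
      _ = _ := by field_simp; ring
  have hlim : Tendsto (fun ε : ℝ => (a + ε + (b + ε)) ^ 2) (𝓝[>] 0) (𝓝 ((a + 0 + (b + 0)) ^ 2)) :=
    (Continuous.tendsto (f := fun ε : ℝ => (a + ε + (b + ε)) ^ 2) (by fun_prop) 0).mono_left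
      nhdsWithin_le_nhds
  simp only [add_zero] at hlim
  exact ge_of_tendsto hlim (eventually_mem_nhdsWithin.mono fun ε hε => key ε hε)

/-- Being linear in the squares, this form can be integrated over cells and summed over n. Letting t
vary afterwards recovers the triangle inequality in L² without loss, by `le_sq_add_of_forall`. -/
theorem norm_add_sq_le_weighted (z w : ℂ) {t : ℝ} (ht : 0 < t) :
    ‖z + w‖ ^ 2 ≤ (1 + t) * ‖z‖ ^ 2 + (1 + t⁻¹) * ‖w‖ ^ 2 := by
  have h1 : ‖z + w‖ ^ 2 ≤ (‖z‖ + ‖w‖) ^ 2 := by gcongr; exact norm_add_le _ _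
  have h2 : 2 * (‖z‖ * ‖w‖) ≤ t * ‖z‖ ^ 2 + t⁻¹ * ‖w‖ ^ 2 := by
    have : t * ‖z‖ ^ 2 + t⁻¹ * ‖w‖ ^ 2 - 2 * (‖z‖ * ‖w‖) = t⁻¹ * (t * ‖z‖ - ‖w‖) ^ 2 := by
      field_simp; ring
    have : 0 ≤ t⁻¹ * (t * ‖z‖ - ‖w‖) ^ 2 := by positivity
    linarith
  nlinarith

/-- Sampling on a Voronoi partition: a discrete upper bound. -/
theorem summable_volume_mul_norm_sq {I : Type*} [Countable I] {x : I → ℝ}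
    (hx : Function.Injective x) (hcover : ⋃ n, voronoi x n = univ) {δ : ℝ} (hδ0 : 0 ≤ δ)
    (hδ : density x = ENNReal.ofReal δ) {u : ℝ → ℂ} (hu : ContDiff ℝ 1 u)
    (hi : Integrable fun t => ‖u t‖ ^ 2) (hdi : Integrable fun t => ‖deriv u t‖ ^ 2) :
    (Summable fun n => volume.real (voronoi x n) * ‖u (x n)‖ ^ 2) ∧
    ∑' n, volume.real (voronoi x n) * ‖u (x n)‖ ^ 2 ≤
      (√(∫ t, ‖u t‖ ^ 2) + 2 * δ / Real.pi * √(∫ t, ‖deriv u t‖ ^ 2)) ^ 2 := by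
  have hp := Real.pi_pos
  have hcu := hu.continuous
  have h1 := hasSum_integral_voronoi hx hcover hi
  have h2 := hasSum_integral_voronoi hx hcover hdi
  have key : ∀ t > 0, ∀ n, volume.real (voronoi x n) * ‖u (x n)‖ ^ 2 ≤
      (1 + t) * (∫ r in voronoi x n, ‖u r‖ ^ 2) +
      (1 + t⁻¹) * ((2 * δ / Real.pi) ^ 2 * ∫ r in voronoi x n, ‖deriv u r‖ ^ 2) := by
    intro t ht n
    obtain ⟨a, b, hV, hac, hcb, ha, hb⟩ := voronoi_eq_Icc hδ0 hδ n
    have hw := wirtinger_Icc hu hac hcb ha hb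
    rw [hV]
    have e1 : volume.real (Icc a b) * ‖u (x n)‖ ^ 2 = ∫ r in Icc a b, ‖u (x n)‖ ^ 2 := by simp
    have hint : ∀ f : ℝ → ℝ, Continuous f → IntegrableOn f (Icc a b) := fun f hf =>
      hf.continuousOn.integrableOn_compact isCompact_Icc
    have e2 : ∫ r in Icc a b, ‖u (x n)‖ ^ 2 ≤
        ∫ r in Icc a b, ((1 + t) * ‖u r‖ ^ 2 + (1 + t⁻¹) * ‖u r - u (x n)‖ ^ 2) := by
      -- The sample u(x_n) is split as u(r) - (u(r) - u(x_n)), and Wirtinger bounds the second part.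
      refine integral_mono (hint _ (by fun_prop)) (hint _ (by fun_prop)) fun r => ?_
      have := norm_add_sq_le_weighted (u r) (-(u r - u (x n))) ht
      rwa [norm_neg, neg_sub, add_sub_cancel] at this
    rw [integral_add (hint _ (by fun_prop)) (hint _ (by fun_prop)), integral_const_mul,
      integral_const_mul] at e2
    rw [e1]
    refine e2.trans ?_
    gcongr
  have hs : ∀ t > 0, HasSum (fun n => (1 + t) * (∫ r in voronoi x n, ‖u r‖ ^ 2) +
      (1 + t⁻¹) * ((2 * δ / Real.pi) ^ 2 * ∫ r in voronoi x n, ‖deriv u r‖ ^ 2))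
      ((1 + t) * (∫ r, ‖u r‖ ^ 2) + (1 + t⁻¹) * ((2 * δ / Real.pi) ^ 2 * ∫ r, ‖deriv u r‖ ^ 2)) :=
    fun t _ => (h1.mul_left _).add ((h2.mul_left _).mul_left _)
  have hsum : Summable fun n => volume.real (voronoi x n) * ‖u (x n)‖ ^ 2 :=
    (hs 1 one_pos).summable.of_nonneg_of_le (fun n => by positivity) (key 1 one_pos)
  refine ⟨hsum, le_sq_add_of_forall (by positivity) (by positivity) fun t ht => ?_⟩
  rw [mul_pow, Real.sq_sqrt (integral_nonneg fun _ => by positivity),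
    Real.sq_sqrt (integral_nonneg fun _ => by positivity)]
  exact hasSum_le (key t ht) hsum.hasSum (hs t ht)

theorem summable_prod_fin {I : Type*} {k : ℕ} {a : I × Fin k → ℝ} (h0 : ∀ p, 0 ≤ a p)
    (h : ∀ m, Summable fun n => a (n, m)) :
    Summable a ∧ ∑' p, a p = ∑ m, ∑' n, a (n, m) := by
  have hs : Summable a := by
    rw [summable_prod_of_nonneg h0]
    refine ⟨fun n => Summable.of_finite, ?_⟩
    simp only [tsum_fintype]
    exact summable_sum fun m _ => h m
  refine ⟨hs, ?_⟩
  rw [hs.tsum_prod]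
  simp only [tsum_fintype]
  exact Summable.tsum_finsetSum fun m _ => h m

theorem monomialWeight_nonneg {I : Type*} (x : I → ℝ) (n : I) (m : ℕ) :
    0 ≤ monomialWeight x n m := by
  unfold monomialWeight
  have : 0 ≤ ∫ t in voronoi x n, (t - x n) ^ (2 * m) :=
    integral_nonneg fun t => (even_two_mul m).pow_nonneg _
  positivity

theorem integrableOn_voronoi {I : Type*} {x : I → ℝ} {δ : ℝ} (hδ0 : 0 ≤ δ)
    (hδ : density x = ENNReal.ofReal δ) (n : I) {f : ℝ → ℝ} (hf : Continuous f) :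
    IntegrableOn f (voronoi x n) := by
  obtain ⟨a, b, hV, -⟩ := voronoi_eq_Icc hδ0 hδ n
  rw [hV]
  exact hf.continuousOn.integrableOn_compact isCompact_Icc

theorem setIntegral_voronoi_le {I : Type*} {x : I → ℝ} {δ : ℝ} (hδ0 : 0 ≤ δ)
    (hδ : density x = ENNReal.ofReal δ) (n : I) {f : ℝ → ℝ} (hf : Continuous f) {C : ℝ}
    (hC : ∀ t ∈ voronoi x n, f t ≤ C) :
    ∫ t in voronoi x n, f t ≤ volume.real (voronoi x n) * C := by
  have h := setIntegral_mono_on (integrableOn_voronoi hδ0 hδ n hf)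
    (integrableOn_voronoi hδ0 hδ n (continuous_const (y := C)))
    (isClosed_voronoi x n).measurableSet hC
  simpa using h

theorem monomialWeight_le {I : Type*} {x : I → ℝ} {δ : ℝ} (hδ0 : 0 ≤ δ)
    (hδ : density x = ENNReal.ofReal δ) (n : I) (m : ℕ) :
    monomialWeight x n m ≤ (δ ^ m) ^ 2 / m.factorial * volume.real (voronoi x n) := by
  unfold monomialWeight
  have h : ∫ t in voronoi x n, (t - x n) ^ (2 * m) ≤ volume.real (voronoi x n) * (δ ^ m) ^ 2 := by
    refine setIntegral_voronoi_le hδ0 hδ n (by fun_prop) fun t ht => ?_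
    have := abs_sub_le_of_mem_voronoi hδ0 hδ ht
    rw [← (even_two_mul m).pow_abs, ← pow_mul, mul_comm m 2]
    gcongr
  calc _ ≤ 1 / (m.factorial : ℝ) * (volume.real (voronoi x n) * (δ ^ m) ^ 2) := by gcongr
    _ = _ := by ring

/-! ### Upper and lower frame bounds -/

section FrameBounds

variable {Ω : Set ℝ} {I : Type*} [Countable I] {x : I → ℝ} {δ : ℝ}

/-- The upper bound for the weighted Voronoi sums of a derivative. -/
theorem summable_volume_mul_iteratedDeriv (hΩ : IsCompact Ω) (hx : Function.Injective x)
    (hcover : ⋃ n, voronoi x n = univ) (hδ0 : 0 ≤ δ) (hδ : density x = ENNReal.ofReal δ)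
    (f : bandlimited Ω) (m : ℕ) :
    (Summable fun n => volume.real (voronoi x n) * ‖iteratedDeriv m (contRep f) (x n)‖ ^ 2) ∧
    ∑' n, volume.real (voronoi x n) * ‖iteratedDeriv m (contRep f) (x n)‖ ^ 2 ≤
      ((1 + 2 * (δ * maxFreq Ω) / Real.pi) * (maxFreq Ω ^ m * ‖f‖)) ^ 2 := by
  have hM := maxFreq_nonneg Ω
  have hp := Real.pi_pos
  have h := summable_volume_mul_norm_sq hx hcover hδ0 hδ (u := iteratedDeriv m (contRep f)) ?_
    (integrable_iteratedDeriv_contRep hΩ f m) ?_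
  · refine ⟨h.1, h.2.trans ?_⟩
    have h1 : ∀ k, √(∫ t, ‖iteratedDeriv k (contRep f) t‖ ^ 2) ≤ maxFreq Ω ^ k * ‖f‖ := by
      intro k
      refine Real.sqrt_le_iff.2 ⟨by positivity, ?_⟩
      rw [mul_pow]
      exact integral_iteratedDeriv_contRep_le hΩ f k
    have h2 := h1 (m + 1)
    rw [iteratedDeriv_succ] at h2
    calc _ ≤ (maxFreq Ω ^ m * ‖f‖ + 2 * δ / Real.pi * (maxFreq Ω ^ (m + 1) * ‖f‖)) ^ 2 := by
          gcongr
          exact h1 m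
      _ = _ := by congr 1; rw [pow_succ]; ring
  · rw [iteratedDeriv_eq_iterate]
    exact ContDiff.iterate_deriv' 1 m (by exact_mod_cast contDiff_contRep hΩ f (1 + m : ℕ))
  · rw [← iteratedDeriv_succ]
    exact integrable_iteratedDeriv_contRep hΩ f (m + 1)

/-- Since |t - x_n| ≤ δ on the cell, the weight is at most δ^(2m)/m! times the cell length. The
bounds for the single m then form a partial sum of the series of exp((δm_Ω)²). -/
theorem summable_monomialWeight_mul (hΩ : IsCompact Ω) (hx : Function.Injective x)
    (hcover : ⋃ n, voronoi x n = univ) (hδ0 : 0 ≤ δ) (hδ : density x = ENNReal.ofReal δ)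
    (f : bandlimited Ω) (s : ℕ) :
    (Summable fun p : I × Fin (s + 1) =>
      monomialWeight x p.1 p.2 * ‖iteratedDeriv p.2 (contRep f) (x p.1)‖ ^ 2) ∧
    ∑' p : I × Fin (s + 1), monomialWeight x p.1 p.2 *
        ‖iteratedDeriv p.2 (contRep f) (x p.1)‖ ^ 2 ≤
      (1 + 2 * (δ * maxFreq Ω) / Real.pi) ^ 2 * Real.exp ((δ * maxFreq Ω) ^ 2) * ‖f‖ ^ 2 := by
  have hb : ∀ (m : ℕ) (n : I), monomialWeight x n m * ‖iteratedDeriv m (contRep f) (x n)‖ ^ 2 ≤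
      (δ ^ m) ^ 2 / m.factorial *
        (volume.real (voronoi x n) * ‖iteratedDeriv m (contRep f) (x n)‖ ^ 2) := by
    intro m n
    rw [← mul_assoc]
    gcongr
    exact monomialWeight_le hδ0 hδ n m
  have hS := fun m => (summable_volume_mul_iteratedDeriv hΩ hx hcover hδ0 hδ f m)
  have hsum : ∀ m : ℕ, Summable fun n =>
      monomialWeight x n m * ‖iteratedDeriv m (contRep f) (x n)‖ ^ 2 := fun m =>
    ((hS m).1.mul_left _).of_nonneg_of_le
      (fun n => mul_nonneg (monomialWeight_nonneg x n m) (by positivity)) (hb m)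
  have h := summable_prod_fin (I := I) (k := s + 1) (a := fun p =>
    monomialWeight x p.1 p.2 * ‖iteratedDeriv p.2 (contRep f) (x p.1)‖ ^ 2)
    (fun p => mul_nonneg (monomialWeight_nonneg x _ _) (by positivity)) (fun m => hsum m)
  refine ⟨h.1, ?_⟩
  rw [h.2]
  set K := (1 + 2 * (δ * maxFreq Ω) / Real.pi) ^ 2 with hK
  have hle : ∀ m : ℕ, ∑' n, monomialWeight x n m * ‖iteratedDeriv m (contRep f) (x n)‖ ^ 2 ≤
      ((δ * maxFreq Ω) ^ 2) ^ m / m.factorial * (K * ‖f‖ ^ 2) := by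
    intro m
    refine ((hsum m).tsum_le_tsum (hb m) ((hS m).1.mul_left _)).trans ?_
    rw [tsum_mul_left]
    calc _ ≤ (δ ^ m) ^ 2 / m.factorial *
          ((1 + 2 * (δ * maxFreq Ω) / Real.pi) * (maxFreq Ω ^ m * ‖f‖)) ^ 2 := by
          gcongr
          exact (hS m).2
      _ = _ := by rw [hK]; ring
  calc _ ≤ ∑ m : Fin (s + 1), ((δ * maxFreq Ω) ^ 2) ^ (m : ℕ) / (m : ℕ).factorial * (K * ‖f‖ ^ 2) :=
        Finset.sum_le_sum fun m _ => hle m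
    _ = (∑ m ∈ Finset.range (s + 1), ((δ * maxFreq Ω) ^ 2) ^ m / m.factorial) * (K * ‖f‖ ^ 2) := by
        rw [← Finset.sum_mul, Finset.sum_range]
    _ ≤ Real.exp ((δ * maxFreq Ω) ^ 2) * (K * ‖f‖ ^ 2) := by
        gcongr
        exact Real.sum_le_exp_of_nonneg (sq_nonneg _) _
    _ = _ := by ring

/-- Cauchy–Schwarz with one factor 1/m! given to each side; Σ 1/m! ≤ e is the origin of e⁻¹ in the
lower frame bound. -/
theorem norm_taylorSum_sq_le (F : ℝ → ℂ) (s : ℕ) (c t : ℝ) :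
    ‖taylorSum F s c t‖ ^ 2 ≤ Real.exp 1 * ∑ m ∈ Finset.range (s + 1),
      (t - c) ^ (2 * m) / m.factorial * ‖iteratedDeriv m F c‖ ^ 2 := by
  have h1 : ‖taylorSum F s c t‖ ≤ ∑ m ∈ Finset.range (s + 1),
      |t - c| ^ m / m.factorial * ‖iteratedDeriv m F c‖ := by
    refine (norm_sum_le _ _).trans (le_of_eq (Finset.sum_congr rfl fun m _ => ?_))
    rw [norm_mul, Complex.norm_real, Real.norm_eq_abs, abs_div, abs_pow, Nat.abs_cast]
  have h2 := Finset.sum_sq_le_sum_mul_sum_of_sq_le_mul (Finset.range (s + 1))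
    (r := fun m => |t - c| ^ m / (m.factorial : ℝ) * ‖iteratedDeriv m F c‖)
    (f := fun m => 1 ^ m / (m.factorial : ℝ))
    (g := fun m => (t - c) ^ (2 * m) / m.factorial * ‖iteratedDeriv m F c‖ ^ 2)
    (fun m _ => by positivity)
    (fun m _ => mul_nonneg (div_nonneg ((even_two_mul m).pow_nonneg _) (by positivity))
      (by positivity))
    (fun m _ => le_of_eq <| by
      rw [← (even_two_mul m).pow_abs, mul_comm 2 m, pow_mul]
      field_simp
      simp)
  calc _ ≤ (∑ m ∈ Finset.range (s + 1), |t - c| ^ m / m.factorial * ‖iteratedDeriv m F c‖) ^ 2 := by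
        gcongr
    _ ≤ _ := h2
    _ ≤ _ := by
        gcongr
        · exact Finset.sum_nonneg fun m _ =>
            mul_nonneg (div_nonneg ((even_two_mul m).pow_nonneg _) (by positivity)) (by positivity)
        · exact Real.sum_le_exp_of_nonneg zero_le_one _

/-- Taylor part plus remainder gives ‖f‖ ≤ √(eS) + q‖f‖. Leaving q free serves both the exact Taylor
factor and the larger value of `hTilde`. -/
theorem lower_bound_monomialWeight_mul (hΩ : IsCompact Ω) (hx : Function.Injective x)
    (hcover : ⋃ n, voronoi x n = univ) (hδ0 : 0 ≤ δ) (hδ : density x = ENNReal.ofReal δ)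
    (f : bandlimited Ω) (s : ℕ) {q : ℝ}
    (hq : (δ * maxFreq Ω) ^ (s + 1) / ((s + 1).factorial : ℝ) ≤ q) (hq1 : q ≤ 1) :
    (Real.exp 1)⁻¹ * (1 - q) ^ 2 * ‖f‖ ^ 2 ≤ ∑' p : I × Fin (s + 1), monomialWeight x p.1 p.2 *
        ‖iteratedDeriv p.2 (contRep f) (x p.1)‖ ^ 2 := by
  have hM := maxFreq_nonneg Ω
  have he := Real.exp_pos 1
  have hq0 : 0 ≤ q := le_trans (by positivity) hq
  have hFs : ∀ n : ℕ, ContDiff ℝ n (contRep f) := fun n => contDiff_contRep hΩ f n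
  set F := contRep f with hF
  have hcF : Continuous F := (hFs 0).continuous
  have hsum := (summable_monomialWeight_mul hΩ hx hcover hδ0 hδ f s).1
  rw [← hF] at hsum
  set S := ∑' p : I × Fin (s + 1), monomialWeight x p.1 p.2 * ‖iteratedDeriv p.2 F (x p.1)‖ ^ 2
    with hS
  have hS0 : 0 ≤ S := tsum_nonneg fun p => mul_nonneg (monomialWeight_nonneg _ _ _) (by positivity)
  have hfib : HasSum (fun n => ∑ m : Fin (s + 1),
      monomialWeight x n m * ‖iteratedDeriv m F (x n)‖ ^ 2) S :=
    hsum.hasSum.prod_fiberwise fun n => hasSum_fintype _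
  have hi0 : Integrable fun t => ‖F t‖ ^ 2 := by
    simpa using integrable_iteratedDeriv_contRep hΩ f 0
  have hs0 := hasSum_integral_voronoi hx hcover hi0
  have hs1 := hasSum_integral_voronoi hx hcover (integrable_iteratedDeriv_contRep hΩ f (s + 1))
  rw [hF, integral_contRep hΩ, ← hF] at hs0
  set D := δ ^ (s + 1) / ((s + 1).factorial : ℝ) with hD
  have key : ∀ t > 0, ∀ n, ∫ r in voronoi x n, ‖F r‖ ^ 2 ≤
      (1 + t) * (Real.exp 1 * ∑ m : Fin (s + 1),
        monomialWeight x n m * ‖iteratedDeriv m F (x n)‖ ^ 2) +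
      (1 + t⁻¹) * (D ^ 2 * ∫ r in voronoi x n, ‖iteratedDeriv (s + 1) F r‖ ^ 2) := by
    intro t ht n
    have hT : Continuous (taylorSum F s (x n)) := by unfold taylorSum; fun_prop
    have hint : ∀ g : ℝ → ℝ, Continuous g → IntegrableOn g (voronoi x n) := fun g hg =>
      integrableOn_voronoi hδ0 hδ n hg
    have e1 : ∫ r in voronoi x n, ‖F r‖ ^ 2 ≤ ∫ r in voronoi x n,
        ((1 + t) * ‖taylorSum F s (x n) r‖ ^ 2 +
          (1 + t⁻¹) * ‖F r - taylorSum F s (x n) r‖ ^ 2) := by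
      refine integral_mono (hint _ (by fun_prop)) (hint _ (by fun_prop)) fun r => ?_
      have := norm_add_sq_le_weighted (taylorSum F s (x n) r) (F r - taylorSum F s (x n) r) ht
      rwa [add_sub_cancel] at this
    rw [integral_add (hint _ (by fun_prop)) (hint _ (by fun_prop)), integral_const_mul,
      integral_const_mul] at e1
    have e2 : ∫ r in voronoi x n, ‖F r - taylorSum F s (x n) r‖ ^ 2 ≤
        D ^ 2 * ∫ r in voronoi x n, ‖iteratedDeriv (s + 1) F r‖ ^ 2 := by
      obtain ⟨a, b, hV, hac, hcb, ha, hb⟩ := voronoi_eq_Icc hδ0 hδ n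
      rw [hV]
      exact integral_norm_sub_taylorSum_sq_le hFs s hac hcb ha hb
    have e3 : ∫ r in voronoi x n, ‖taylorSum F s (x n) r‖ ^ 2 ≤
        Real.exp 1 * ∑ m : Fin (s + 1), monomialWeight x n m * ‖iteratedDeriv m F (x n)‖ ^ 2 := by
      have : ∫ r in voronoi x n, ‖taylorSum F s (x n) r‖ ^ 2 ≤ ∫ r in voronoi x n,
          Real.exp 1 * ∑ m ∈ Finset.range (s + 1),
            (r - x n) ^ (2 * m) / m.factorial * ‖iteratedDeriv m F (x n)‖ ^ 2 :=
        integral_mono (hint _ (by fun_prop)) (hint _ (by fun_prop)) fun r =>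
          norm_taylorSum_sq_le F s (x n) r
      refine this.trans (le_of_eq ?_)
      rw [integral_const_mul, integral_finsetSum _ fun m _ => hint _ (by fun_prop), Finset.sum_range]
      congr 1
      refine Finset.sum_congr rfl fun m _ => ?_
      rw [integral_mul_const, integral_div, monomialWeight, one_div_mul_eq_div]
    refine e1.trans ?_
    gcongr
  have hmain : ‖f‖ ^ 2 ≤ (√(Real.exp 1 * S) + q * ‖f‖) ^ 2 := by
    refine le_sq_add_of_forall (by positivity) (by positivity) fun t ht => ?_
    refine (hasSum_le (key t ht) hs0 (((hfib.mul_left _).mul_left _).add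
      ((hs1.mul_left _).mul_left _))).trans ?_
    rw [Real.sq_sqrt (by positivity)]
    gcongr
    calc _ ≤ D ^ 2 * ((maxFreq Ω ^ (s + 1)) ^ 2 * ‖f‖ ^ 2) := by
          gcongr
          exact integral_iteratedDeriv_contRep_le hΩ f (s + 1)
      _ = ((δ * maxFreq Ω) ^ (s + 1) / ((s + 1).factorial : ℝ) * ‖f‖) ^ 2 := by rw [hD]; ring
      _ ≤ (q * ‖f‖) ^ 2 := by gcongr
  have h1 : (1 - q) * ‖f‖ ≤ √(Real.exp 1 * S) := by
    have := (pow_le_pow_iff_left₀ (norm_nonneg f) (by positivity) two_ne_zero).1 hmain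
    linarith
  have h2 : ((1 - q) * ‖f‖) ^ 2 ≤ Real.exp 1 * S := by
    rw [← Real.sq_sqrt (show 0 ≤ Real.exp 1 * S by positivity)]
    have : 0 ≤ 1 - q := by linarith
    gcongr
  rw [mul_assoc, inv_mul_le_iff₀ he, ← mul_pow]
  exact h2

end FrameBounds

/-! ### The limit of vanishing bunch width -/

theorem abs_prod_sub_pow_le {ι : Type*} (S : Finset ι) (u : ι → ℝ) {v V d : ℝ} (hv : |v| ≤ V)
    (hd : 0 ≤ d) (hu : ∀ i ∈ S, |u i - v| ≤ d) :
    |∏ i ∈ S, u i - v ^ S.card| ≤ (V + d) ^ S.card - V ^ S.card := by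
  classical
  induction S using Finset.induction_on with
  | empty => simp
  | insert i S hi ih =>
    have hV : 0 ≤ V := (abs_nonneg v).trans hv
    have h1 := ih fun j hj => hu j (Finset.mem_insert_of_mem hj)
    have h2 := hu i (Finset.mem_insert_self i S)
    have h3 : |u i| ≤ V + d := by
      calc |u i| = |v + (u i - v)| := by ring_nf
        _ ≤ |v| + |u i - v| := abs_add_le _ _
        _ ≤ _ := by gcongr
    have h4 : |v ^ S.card| ≤ V ^ S.card := by rw [abs_pow]; gcongr
    rw [Finset.prod_insert hi, Finset.card_insert_of_notMem hi, pow_succ', pow_succ', pow_succ']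
    calc |u i * ∏ j ∈ S, u j - v * v ^ S.card|
        = |u i * (∏ j ∈ S, u j - v ^ S.card) + (u i - v) * v ^ S.card| := by ring_nf
      _ ≤ |u i| * |∏ j ∈ S, u j - v ^ S.card| + |u i - v| * |v ^ S.card| := by
          rw [← abs_mul, ← abs_mul]; exact abs_add_le _ _
      _ ≤ (V + d) * ((V + d) ^ S.card - V ^ S.card) + d * V ^ S.card := by gcongr
      _ = _ := by ring

theorem abs_newton_sq_sub_le {s : ℕ} (y : Fin (s + 1) → ℝ) (m : Fin (s + 1)) {t c δ h : ℝ}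
    (hh : 0 ≤ h) (ht : |t - c| ≤ δ) (hy : ∀ k, |y k - c| ≤ h) :
    |newton y m t ^ 2 - (t - c) ^ (2 * (m : ℕ))| ≤ (δ + h) ^ (2 * (m : ℕ)) - δ ^ (2 * (m : ℕ)) := by
  have hδ : 0 ≤ δ := (abs_nonneg _).trans ht
  -- Applied to the squared factors: d = 2δh + h² is chosen so that δ² + d = (δ+h)².
  have h1 := abs_prod_sub_pow_le (Finset.Iio m) (fun l => (t - y l) ^ 2) (v := (t - c) ^ 2)
    (V := δ ^ 2) (d := 2 * δ * h + h ^ 2) (by rw [abs_pow]; gcongr) (by positivity) (fun l _ => by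
      have : (t - y l) ^ 2 - (t - c) ^ 2 = -(2 * (t - c) * (y l - c)) + (y l - c) ^ 2 := by ring
      rw [this]
      refine (abs_add_le _ _).trans ?_
      rw [abs_neg, abs_mul, abs_mul, abs_pow, abs_two]
      have := hy l
      gcongr)
  rw [Fin.card_Iio, show δ ^ 2 + (2 * δ * h + h ^ 2) = (δ + h) ^ 2 by ring, ← pow_mul, ← pow_mul,
    ← pow_mul, Finset.prod_pow] at h1
  exact h1

/-- The cross term is linear in z - w, while only ‖z - w‖² is controlled; the parameter η shifts the
cost to ‖w‖². -/
theorem abs_mul_norm_sq_sub_le {P Q W C ω η : ℝ} (hP0 : 0 ≤ P) (hP : P ≤ W * C)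
    (hPQ : |P - Q| ≤ W * ω) (hη : 0 < η) (z w : ℂ) :
    |P * ‖z‖ ^ 2 - Q * ‖w‖ ^ 2| ≤
      C * (1 + η⁻¹) * (W * ‖z - w‖ ^ 2) + (C * η + ω) * (W * ‖w‖ ^ 2) := by
  have h1 : |‖z‖ ^ 2 - ‖w‖ ^ 2| ≤ (1 + η⁻¹) * ‖z - w‖ ^ 2 + η * ‖w‖ ^ 2 := by
    have e1 : |‖z‖ - ‖w‖| ≤ ‖z - w‖ := abs_norm_sub_norm_le z w
    have e2 : ‖z‖ ^ 2 - ‖w‖ ^ 2 = (‖z‖ - ‖w‖) ^ 2 + 2 * ‖w‖ * (‖z‖ - ‖w‖) := by ring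
    have e3 : 2 * (‖w‖ * ‖z - w‖) ≤ η * ‖w‖ ^ 2 + η⁻¹ * ‖z - w‖ ^ 2 := by
      have : η * ‖w‖ ^ 2 + η⁻¹ * ‖z - w‖ ^ 2 - 2 * (‖w‖ * ‖z - w‖) =
          η⁻¹ * (η * ‖w‖ - ‖z - w‖) ^ 2 := by
        field_simp; ring
      have : 0 ≤ η⁻¹ * (η * ‖w‖ - ‖z - w‖) ^ 2 := by positivity
      linarith
    rw [e2]
    refine (abs_add_le _ _).trans ?_
    rw [abs_pow, abs_mul, abs_mul, abs_two, abs_norm]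
    have e4 : |‖z‖ - ‖w‖| ^ 2 ≤ ‖z - w‖ ^ 2 := by gcongr
    have e5 : 2 * ‖w‖ * |‖z‖ - ‖w‖| ≤ 2 * ‖w‖ * ‖z - w‖ := by gcongr
    linarith
  calc |P * ‖z‖ ^ 2 - Q * ‖w‖ ^ 2| = |P * (‖z‖ ^ 2 - ‖w‖ ^ 2) + (P - Q) * ‖w‖ ^ 2| := by ring_nf
    _ ≤ P * |‖z‖ ^ 2 - ‖w‖ ^ 2| + |P - Q| * ‖w‖ ^ 2 := by
        refine (abs_add_le _ _).trans (le_of_eq ?_)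
        rw [abs_mul, abs_mul, abs_of_nonneg hP0, abs_of_nonneg (sq_nonneg ‖w‖)]
    _ ≤ (W * C) * ((1 + η⁻¹) * ‖z - w‖ ^ 2 + η * ‖w‖ ^ 2) + (W * ω) * ‖w‖ ^ 2 := by
        gcongr
        exact hP0.trans hP
    _ = _ := by ring

section Limit

variable {I : Type*} {x : I → ℝ} {δ : ℝ} {s : ℕ} {y : I → Fin (s + 1) → ℝ}

theorem volume_voronoi_le (hδ0 : 0 ≤ δ) (hδ : density x = ENNReal.ofReal δ) (n : I) :
    volume.real (voronoi x n) ≤ 2 * δ := by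
  obtain ⟨a, b, hV, hac, hcb, ha, hb⟩ := voronoi_eq_Icc hδ0 hδ n
  rw [hV, Real.volume_real_Icc_of_le (hac.trans hcb)]
  linarith

theorem IsBunched.abs_sub_le {h : ℝ} (hy : IsBunched x y h) (n : I) (k : Fin (s + 1)) :
    |y n k - x n| ≤ h := by
  obtain ⟨w, -, h2, -, h4⟩ := hy.width
  have h5 : w n ≤ h := h4.1 (mem_range_self n)
  have := h2 n k
  rw [abs_le]
  constructor <;> linarith [this.1, this.2]

/-- The bunch interval lies in the cell, so the integral can be enlarged to the cell, where it is
summable over n. -/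
theorem IsBunched.norm_divDiff_sub_sq_le {h : ℝ} (hy : IsBunched x y h) (hh : 0 ≤ h) (hδ0 : 0 ≤ δ)
    (hδ : density x = ENNReal.ofReal δ) {F : ℝ → ℂ} (hF : ∀ n : ℕ, ContDiff ℝ n F) (n : I)
    (m : Fin (s + 1)) :
    ‖((m : ℕ).factorial : ℂ) * divDiff (y n) m F - iteratedDeriv m F (x n)‖ ^ 2 ≤
      2 * h * ∫ t in voronoi x n, ‖iteratedDeriv (m + 1) F t‖ ^ 2 := by
  obtain ⟨w, h1, h2, h3, h4⟩ := hy.width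
  have h5 : w n ≤ h := h4.1 (mem_range_self n)
  have hcont : Continuous (iteratedDeriv (m + 1) F) :=
    (hF (m + 1)).continuous_iteratedDeriv _ le_rfl
  refine (BunchedSampling.norm_divDiff_sub_sq_le hF (hy.distinct n) (h2 n)
    (x := x n) ⟨by linarith [h1 n], by linarith [h1 n]⟩ m).trans ?_
  gcongr
  · linarith
  · exact Eventually.of_forall fun t => sq_nonneg _
  · exact integrableOn_voronoi hδ0 hδ n (by fun_prop)
  · exact h3 n

/-- The deviation of a term of the divided-difference frame sum from its limit. -/
theorem IsBunched.abs_term_sub_le {τ : ℝ} (hτ : 0 < τ) (hy : IsBunched x y (τ * δ)) (hδ0 : 0 ≤ δ)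
    (hδ : density x = ENNReal.ofReal δ) {F : ℝ → ℂ} (hF : ∀ n : ℕ, ContDiff ℝ n F) (n : I)
    (m : Fin (s + 1)) :
    |newtonWeight x y n m * ‖divDiff (y n) m F‖ ^ 2 -
      monomialWeight x n m * ‖iteratedDeriv m F (x n)‖ ^ 2| ≤
    (δ + τ * δ) ^ (2 * (m : ℕ)) * (τ + √τ) * (4 * δ ^ 2) *
      (∫ t in voronoi x n, ‖iteratedDeriv (m + 1) F t‖ ^ 2) +
    ((δ + τ * δ) ^ (2 * (m : ℕ)) * √τ + ((δ + τ * δ) ^ (2 * (m : ℕ)) - δ ^ (2 * (m : ℕ)))) *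
      (volume.real (voronoi x n) * ‖iteratedDeriv m F (x n)‖ ^ 2) := by
  set W := volume.real (voronoi x n) with hW
  set C := (δ + τ * δ) ^ (2 * (m : ℕ)) with hC
  set z := ((m : ℕ).factorial : ℂ) * divDiff (y n) m F with hz
  set w := iteratedDeriv m F (x n) with hw
  set T := ∫ t in voronoi x n, ‖iteratedDeriv (m + 1) F t‖ ^ 2 with hT
  have hτδ : 0 ≤ τ * δ := by positivity
  have hN : Continuous (newton (y n) m) := by unfold newton; fun_prop
  have hpt : ∀ t ∈ voronoi x n,
      |newton (y n) m t ^ 2 - (t - x n) ^ (2 * (m : ℕ))| ≤ C - δ ^ (2 * (m : ℕ)) := fun t ht =>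
    abs_newton_sq_sub_le (y n) m hτδ (abs_sub_le_of_mem_voronoi hδ0 hδ ht) (hy.abs_sub_le n)
  set P := ∫ t in voronoi x n, newton (y n) m t ^ 2 with hP
  set Q := ∫ t in voronoi x n, (t - x n) ^ (2 * (m : ℕ)) with hQ
  have hP0 : 0 ≤ P := integral_nonneg fun t => sq_nonneg _
  have hPC : P ≤ W * C := by
    refine setIntegral_voronoi_le hδ0 hδ n (by fun_prop) fun t ht => ?_
    have h1 := (abs_le.1 (hpt t ht)).2
    have h2 : (t - x n) ^ (2 * (m : ℕ)) ≤ δ ^ (2 * (m : ℕ)) := by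
      rw [← (even_two_mul _).pow_abs]
      have := abs_sub_le_of_mem_voronoi hδ0 hδ ht
      gcongr
    linarith
  have hPQ : |P - Q| ≤ W * (C - δ ^ (2 * (m : ℕ))) := by
    rw [hP, hQ, ← integral_sub (integrableOn_voronoi hδ0 hδ n (by fun_prop))
      (integrableOn_voronoi hδ0 hδ n (by fun_prop))]
    exact abs_integral_le_integral_abs.trans
      (setIntegral_voronoi_le hδ0 hδ n (by fun_prop) hpt)
  -- With η = √τ both error terms vanish in the limit: ‖z - w‖² is of order τ, and τ(1 + 1/√τ) = τ +
  -- √τ.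
  have hmain := abs_mul_norm_sq_sub_le (η := √τ) hP0 hPC hPQ
    (Real.sqrt_pos.2 hτ) z w
  have hzw : W * ‖z - w‖ ^ 2 ≤ 2 * δ * (2 * (τ * δ) * T) := by
    have h1 : ‖z - w‖ ^ 2 ≤ 2 * (τ * δ) * T := hy.norm_divDiff_sub_sq_le hτδ hδ0 hδ hF n m
    have h2 : W ≤ 2 * δ := volume_voronoi_le hδ0 hδ n
    gcongr
  -- Writing z = m! D turns the factor m! of the Newton weight into the factor 1/m! of the monomial
  -- weight.
  have hfact : newtonWeight x y n m * ‖divDiff (y n) m F‖ ^ 2 - monomialWeight x n m * ‖w‖ ^ 2 =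
      ((m : ℕ).factorial : ℝ)⁻¹ * (P * ‖z‖ ^ 2 - Q * ‖w‖ ^ 2) := by
    rw [newtonWeight, monomialWeight, hz, norm_mul, Complex.norm_natCast, ← hP, ← hQ]
    have : ((m : ℕ).factorial : ℝ) ≠ 0 := by positivity
    field_simp
  have hC0 : 0 ≤ C := by positivity
  have hf1 : ((m : ℕ).factorial : ℝ)⁻¹ ≤ 1 :=
    inv_le_one_of_one_le₀ (by exact_mod_cast Nat.one_le_iff_ne_zero.2 (Nat.factorial_ne_zero _))
  rw [hfact, abs_mul, abs_of_nonneg (by positivity)]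
  refine (mul_le_of_le_one_left (abs_nonneg _) hf1).trans (hmain.trans ?_)
  refine add_le_add ?_ le_rfl
  calc C * (1 + (√τ)⁻¹) * (W * ‖z - w‖ ^ 2)
      ≤ C * (1 + (√τ)⁻¹) * (2 * δ * (2 * (τ * δ) * T)) := by gcongr
    _ = C * (τ + τ * (√τ)⁻¹) * (4 * δ ^ 2) * T := by ring
    _ = _ := by rw [← div_eq_mul_inv, Real.div_sqrt]

theorem newtonWeight_nonneg (x : I → ℝ) (y : I → Fin (s + 1) → ℝ) (n : I) (m : Fin (s + 1)) :
    0 ≤ newtonWeight x y n m :=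
  mul_nonneg (by positivity) (integral_nonneg fun _ => sq_nonneg _)

/-- The divided-difference frame sums converge to the derivative frame sums, uniformly over the
bunched sampling sets. -/
theorem exists_forall_isBunched_abs_sub_lt [Countable I] {Ω : Set ℝ} (hΩ : IsCompact Ω)
    (hx : Function.Injective x) (hcover : ⋃ n, voronoi x n = univ) (hδ0 : 0 ≤ δ)
    (hδ : density x = ENNReal.ofReal δ) (f : bandlimited Ω) {ε : ℝ} (hε : 0 < ε) :
    ∃ τ₀ > 0, ∀ τ : ℝ, 0 < τ → τ < τ₀ → ∀ y : I → Fin (s + 1) → ℝ, IsBunched x y (τ * δ) →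
      (Summable fun p : I × Fin (s + 1) =>
        newtonWeight x y p.1 p.2 * ‖divDiff (y p.1) p.2 (contRep f)‖ ^ 2) ∧
      |(∑' p : I × Fin (s + 1), newtonWeight x y p.1 p.2 *
          ‖divDiff (y p.1) p.2 (contRep f)‖ ^ 2) -
        ∑' p : I × Fin (s + 1), monomialWeight x p.1 p.2 *
          ‖iteratedDeriv p.2 (contRep f) (x p.1)‖ ^ 2| < ε := by
  have hFs : ∀ n : ℕ, ContDiff ℝ n (contRep f) := fun n => contDiff_contRep hΩ f n
  set F := contRep f with hF
  set T : ℕ → ℝ := fun m => ∫ t, ‖iteratedDeriv m F t‖ ^ 2 with hT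
  set S : ℕ → ℝ := fun m => ∑' n, volume.real (voronoi x n) * ‖iteratedDeriv m F (x n)‖ ^ 2 with hS
  -- This error bound does not see y; it is continuous in τ and zero at τ = 0, hence the uniformity.
  set β : Fin (s + 1) → ℝ → ℝ := fun m τ =>
    (δ + τ * δ) ^ (2 * (m : ℕ)) * (τ + √τ) * (4 * δ ^ 2) * T (m + 1) +
    ((δ + τ * δ) ^ (2 * (m : ℕ)) * √τ + ((δ + τ * δ) ^ (2 * (m : ℕ)) - δ ^ (2 * (m : ℕ)))) * S m
    with hβ
  have hβ0 : Tendsto (fun τ => ∑ m, β m τ) (𝓝 0) (𝓝 0) := by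
    have hc : Continuous fun τ => ∑ m, β m τ := by
      refine continuous_finsetSum _ fun m _ => ?_
      simp only [hβ]
      fun_prop
    have h0 : ∑ m, β m 0 = 0 := Finset.sum_eq_zero fun m _ => by simp [hβ]
    have := hc.tendsto 0
    rwa [h0] at this
  obtain ⟨τ₀, hτ₀, hball⟩ := Metric.eventually_nhds_iff.1 (hβ0.eventually (gt_mem_nhds hε))
  refine ⟨τ₀, hτ₀, fun τ hτ hττ₀ y hy => ?_⟩
  have hlt : ∑ m, β m τ < ε := hball (by rw [Real.dist_0_eq_abs, abs_of_pos hτ]; exact hττ₀)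
  have hmono := (summable_monomialWeight_mul hΩ hx hcover hδ0 hδ f s).1
  rw [← hF] at hmono
  have hmono_m : ∀ m : Fin (s + 1), Summable fun n =>
      monomialWeight x n m * ‖iteratedDeriv m F (x n)‖ ^ 2 := fun m =>
    hmono.comp_injective (i := fun n => (n, m)) fun a b h => congrArg Prod.fst h
  have hbound : ∀ m : Fin (s + 1), HasSum (fun n =>
      (δ + τ * δ) ^ (2 * (m : ℕ)) * (τ + √τ) * (4 * δ ^ 2) *
        (∫ t in voronoi x n, ‖iteratedDeriv (m + 1) F t‖ ^ 2) +
      ((δ + τ * δ) ^ (2 * (m : ℕ)) * √τ + ((δ + τ * δ) ^ (2 * (m : ℕ)) - δ ^ (2 * (m : ℕ)))) *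
        (volume.real (voronoi x n) * ‖iteratedDeriv m F (x n)‖ ^ 2)) (β m τ) := fun m =>
    ((hasSum_integral_voronoi hx hcover
      (integrable_iteratedDeriv_contRep hΩ f (m + 1))).mul_left _).add
      ((summable_volume_mul_iteratedDeriv hΩ hx hcover hδ0 hδ f m).1.hasSum.mul_left _)
  have hterm : ∀ (m : Fin (s + 1)) (n : I), _ := fun m n => hy.abs_term_sub_le hτ hδ0 hδ hFs n m
  have hdiff : ∀ m : Fin (s + 1), Summable fun n =>
      newtonWeight x y n m * ‖divDiff (y n) m F‖ ^ 2 -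
        monomialWeight x n m * ‖iteratedDeriv m F (x n)‖ ^ 2 := fun m =>
    (hbound m).summable.of_norm_bounded (hterm m)
  -- Summability is derived: the differences are dominated, and the derivative sums are already
  -- known to converge.
  have hnewt_m : ∀ m : Fin (s + 1), Summable fun n =>
      newtonWeight x y n m * ‖divDiff (y n) m F‖ ^ 2 := fun m => by
    simpa using (hdiff m).add (hmono_m m)
  have h1 := summable_prod_fin (I := I) (k := s + 1)
    (a := fun p => newtonWeight x y p.1 p.2 * ‖divDiff (y p.1) p.2 F‖ ^ 2)
    (fun p => mul_nonneg (newtonWeight_nonneg x y _ _) (by positivity)) hnewt_m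
  have h2 := summable_prod_fin (I := I) (k := s + 1)
    (a := fun p => monomialWeight x p.1 p.2 * ‖iteratedDeriv p.2 F (x p.1)‖ ^ 2)
    (fun p => mul_nonneg (monomialWeight_nonneg x _ _) (by positivity)) hmono_m
  refine ⟨h1.1, lt_of_le_of_lt ?_ hlt⟩
  rw [h1.2, h2.2, ← Finset.sum_sub_distrib]
  refine (Finset.abs_sum_le_sum_abs _ _).trans (Finset.sum_le_sum fun m _ => ?_)
  rw [← (hnewt_m m).tsum_sub (hmono_m m)]
  rw [← Real.norm_eq_abs]
  exact tsum_of_norm_bounded (hbound m) (hterm m)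

end Limit

/-! ### The frame and the main theorem -/

/-- The weighted derivatives of the translates of `Phi Ω` belong to the bandlimited space. -/
theorem exists_weighted_derivative_family {Ω : Set ℝ} (hΩ : IsCompact Ω) {I : Type*} (x : I → ℝ)
    (s : ℕ) :
    ∃ φ : I × Fin (s + 1) → bandlimited Ω,
      (∀ p, ((φ p : Lp ℂ 2 (volume : Measure ℝ)) : ℝ → ℂ) =ᵐ[volume]
        fun t => (Real.sqrt (monomialWeight x p.1 p.2) : ℂ) *
          iteratedDeriv p.2 (fun u : ℝ => Phi Ω (u - x p.1)) t) ∧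
      ∀ p f, ‖inner ℂ (φ p) f‖ ^ 2 =
        monomialWeight x p.1 p.2 * ‖iteratedDeriv p.2 (contRep f) (x p.1)‖ ^ 2 := by
  choose ψ hψ1 hψ2 using fun p : I × Fin (s + 1) => exists_bandlimited_phi hΩ (x p.1) p.2
  refine ⟨fun p => (Real.sqrt (monomialWeight x p.1 p.2) : ℂ) • ψ p, fun p => ?_, fun p f => ?_⟩
  · rw [Submodule.coe_smul]
    filter_upwards [Lp.coeFn_smul (Real.sqrt (monomialWeight x p.1 p.2) : ℂ)
      (ψ p : Lp ℂ 2 (volume : Measure ℝ)), hψ1 p] with t h1 h2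
    rw [h1, Pi.smul_apply, h2, smul_eq_mul]
  · beta_reduce
    have h : inner ℂ ((Real.sqrt (monomialWeight x p.1 p.2) : ℂ) • ψ p) f =
      (starRingEnd ℂ) (Real.sqrt (monomialWeight x p.1 p.2) : ℂ) * inner ℂ (ψ p) f :=
      inner_smul_left (E := Lp ℂ 2 (volume : Measure ℝ)) _ _ _
    rw [h, norm_mul, hψ2, mul_pow, Complex.conj_ofReal, Complex.norm_real,
      Real.norm_eq_abs, sq_abs, Real.sq_sqrt (monomialWeight_nonneg x _ _)]

end BunchedSampling

end

theorem mainTheorem10 :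
    -- the density constant of the divided-difference frame is asymptotic to `(s+1)/e`
    Asymptotics.IsEquivalent (atTop ×ˢ 𝓝[≥] (0 : ℝ))
      (fun p : ℕ × ℝ => BunchedSampling.HTilde p.1 p.2 1)
      (fun p : ℕ × ℝ => 1 / Real.exp 1 * ((p.1 : ℝ) + 1)) ∧
    ∀ (Ω : Set ℝ) (_hΩ : IsCompact Ω) (I : Type*) (_hI : Countable I) (x : I → ℝ)
      (_hx : Function.Injective x) (_hcover : ⋃ n, BunchedSampling.voronoi x n = univ)
      (δ : ℝ) (_hδ0 : 0 ≤ δ) (_hδ : BunchedSampling.density x = ENNReal.ofReal δ) (s : ℕ),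
      -- as the bunch width tends to zero, the divided-difference frame sums converge to the
      -- derivative frame sums
      (∀ f : BunchedSampling.bandlimited Ω, ∀ F : ℝ → ℂ, Continuous F →
        ((f : Lp ℂ 2 (volume : Measure ℝ)) : ℝ → ℂ) =ᵐ[volume] F →
        (Summable fun p : I × Fin (s + 1) =>
          BunchedSampling.monomialWeight x p.1 p.2 * ‖iteratedDeriv p.2 F (x p.1)‖ ^ 2) ∧
        ∀ ε > 0, ∃ τ₀ > 0, ∀ τ : ℝ, 0 < τ → τ < τ₀ → ∀ y : I → Fin (s + 1) → ℝ,
          BunchedSampling.IsBunched x y (τ * δ) →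
          (Summable fun p : I × Fin (s + 1) =>
            BunchedSampling.newtonWeight x y p.1 p.2 *
              ‖BunchedSampling.divDiff (y p.1) p.2 F‖ ^ 2) ∧
          |(∑' p : I × Fin (s + 1), BunchedSampling.newtonWeight x y p.1 p.2 *
              ‖BunchedSampling.divDiff (y p.1) p.2 F‖ ^ 2) -
            ∑' p : I × Fin (s + 1), BunchedSampling.monomialWeight x p.1 p.2 *
              ‖iteratedDeriv p.2 F (x p.1)‖ ^ 2| < ε) ∧
      -- the weighted derivatives form a frame for `B(Ω)`
      (δ * BunchedSampling.maxFreq Ω < 1 / Real.exp 1 * ((s : ℝ) + 1) →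
        ∃ φ : I × Fin (s + 1) → BunchedSampling.bandlimited Ω,
          (∀ p, ((φ p : Lp ℂ 2 (volume : Measure ℝ)) : ℝ → ℂ) =ᵐ[volume]
            fun t => (Real.sqrt (BunchedSampling.monomialWeight x p.1 p.2) : ℂ) *
              iteratedDeriv p.2 (fun u : ℝ => BunchedSampling.Phi Ω (u - x p.1)) t) ∧
          (∃ A, BunchedSampling.IsFrameWithBounds φ A
            ((1 + 2 * (δ * BunchedSampling.maxFreq Ω) / Real.pi) ^ 2 *
              Real.exp ((δ * BunchedSampling.maxFreq Ω) ^ 2))) ∧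
          (δ * BunchedSampling.maxFreq Ω < BunchedSampling.HTilde s 0 1 →
            BunchedSampling.IsFrameWithBounds φ
              ((Real.exp 1)⁻¹ *
                (1 - BunchedSampling.hTilde s 0 (δ * BunchedSampling.maxFreq Ω)) ^ 2)
              ((1 + 2 * (δ * BunchedSampling.maxFreq Ω) / Real.pi) ^ 2 *
                Real.exp ((δ * BunchedSampling.maxFreq Ω) ^ 2)))) := by
  refine ⟨BunchedSampling.isEquivalent_HTilde, ?_⟩
  intro Ω hΩ I _ x hx hcover δ hδ0 hδ s
  have hM := BunchedSampling.maxFreq_nonneg Ω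
  have hz : 0 ≤ δ * BunchedSampling.maxFreq Ω := mul_nonneg hδ0 hM
  refine ⟨fun f F hF hfF => ?_, fun hlt => ?_⟩
  · obtain rfl := BunchedSampling.eq_contRep hΩ f hF hfF
    exact ⟨(BunchedSampling.summable_monomialWeight_mul hΩ hx hcover hδ0 hδ f s).1, fun ε hε =>
      BunchedSampling.exists_forall_isBunched_abs_sub_lt hΩ hx hcover hδ0 hδ f hε⟩
  · obtain ⟨φ, hφ, hinner⟩ := BunchedSampling.exists_weighted_derivative_family hΩ x s
    have hframe : ∀ q : ℝ,
        (δ * BunchedSampling.maxFreq Ω) ^ (s + 1) / ((s + 1).factorial : ℝ) ≤ q → q < 1 →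
        BunchedSampling.IsFrameWithBounds φ ((Real.exp 1)⁻¹ * (1 - q) ^ 2)
          ((1 + 2 * (δ * BunchedSampling.maxFreq Ω) / Real.pi) ^ 2 *
            Real.exp ((δ * BunchedSampling.maxFreq Ω) ^ 2)) := by
      intro q hq hq1
      have hp := Real.pi_pos
      have h1 : 0 < 1 - q := by linarith
      refine ⟨by positivity, by positivity, fun f => ?_, fun f => ?_, fun f => ?_⟩ <;>
        simp only [hinner]
      · exact (BunchedSampling.summable_monomialWeight_mul hΩ hx hcover hδ0 hδ f s).1
      · exact BunchedSampling.lower_bound_monomialWeight_mul hΩ hx hcover hδ0 hδ f s hq hq1.le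
      · exact (BunchedSampling.summable_monomialWeight_mul hΩ hx hcover hδ0 hδ f s).2
    -- First q is the Taylor factor itself, below 1 by the Stirling bound; then q is `hTilde s 0`,
    -- which is larger by the factor 1 + 4z/π.
    refine ⟨φ, hφ, ⟨_, hframe _ le_rfl ?_⟩, fun hH => hframe _ ?_ ?_⟩
    · rw [div_lt_one (by positivity)]
      exact BunchedSampling.pow_lt_factorial_of_lt hz (by omega) (by exact_mod_cast hlt)
    · have hp := Real.pi_pos
      unfold BunchedSampling.hTilde
      rw [add_zero, one_pow, one_mul]
      exact le_mul_of_one_le_right (by positivity) (le_add_of_nonneg_right (by positivity))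
    · exact (BunchedSampling.lt_HTilde_iff s le_rfl hz).1 hH
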